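/- Let $v\in(0,1)$, write $\Sigma^2:=\Sigma_+^2+\Sigma_-^2$, and consider on $\mathbb{R}^4\ni(\Sigma_+,\Sigma_-,N_2,N_3)$ the system \[ \begin{aligned} \Sigma_+'&=2(1-\Sigma^2)(1+2v\Sigma_+), & \Sigma_-'&=4v(1-\Sigma^2)\Sigma_-+2\sqrt3\,(N_2^2-N_3^2),\\ N_2'&=-2(2v\Sigma^2+\Sigma_++\sqrt3\,\Sigma_-)N_2, & N_3'&=-2(2v\Sigma^2+\Sigma_+-\sqrt3\,\Sigma_-)N_3, \end{aligned} \] with the constraint $1-\Sigma^2-(N_2-N_3)^2=0$. The Bianchi type $\mathrm{VI}_0$ state space consists of the points with $N_2>0$, $N_3<0$ that satisfy the constraint. Its boundary is made up of the sets of points satisfying the constraint with $N_2>0=N_3$ (type $\mathrm{II}_2$), with $N_3<0=N_2$ (type $\mathrm{II}_3$), and with $N_2=N_3=0$ (the Kasner circle $\mathrm{K}$, $\Sigma^2=1$). Let $\Sigma_2:=\Sigma_++\sqrt3\,\Sigma_-$, $\Sigma_3:=\Sigma_+-\sqrt3\,\Sigma_-$, let $A_\alpha:=\{p\in \mathrm{K}:\Sigma_\alpha\le-2v\}$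 for $\alpha=2,3$, and let $S:=\mathrm{K}\setminus\mathrm{int}(A_2\cup A_3)$ (the stable set), with the interior taken relative to $\mathrm{K}$. Let $\mathrm{T}_1$ (the Taub point) be the point of $\mathrm{K}$ with $(\Sigma_+,\Sigma_-)=(-1,0)$. Through every point of the type $\mathrm{VI}_0$ state space there is a unique orbit in this space; it is defined for all times. The $\alpha$- and $\omega$-limit sets of the type $\mathrm{VI}_0$ orbits are non-empty and satisfy the following. (i) If $v\in(0,1/2]$, then the $\alpha$-limit set of every orbit is contained in $A_2\cap A_3$, and the $\omega$-limit set of every orbit is contained in $S$. If $v=1/2$, then $A_2\cap A_3=\{\mathrm{T}_1\}$, so that every $\alpha$-limit set is $\{\mathrm{T}_1\}$. (ii) If $v\in(1/2,1)$, then the point \[ p_{\mathrm{VI}_0}:=\left(-\frac1{2v},\,0,\,\frac{\sqrt{1-1/(4v^2)}}2,\,-\frac{\sqrt{1-1/(4v^2)}}2\right) \] is a fixed point in the type $\mathrm{VI}_0$ state space, and the $\alpha$-limit set of every orbit is $\{p_{\mathrm{VI}_0}\}$. The subset $\Sigma_+=-1/(2v)$ is invariant. The part of $\mathrm{II}_2\cup\mathrm{II}_3\cup\mathrm{K}$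 with $\Sigma_+=-1/(2v)$ is a heteroclinic chain (cycle) of period 2: it consists of two distinct points $a,b\in\mathrm{K}$, a type $\mathrm{II}_2$ orbit with $\alpha$-limit set $\{a\}$ and $\omega$-limit set $\{b\}$, and a type $\mathrm{II}_3$ orbit with $\alpha$-limit set $\{b\}$ and $\omega$-limit set $\{a\}$. The $\omega$-limit set of every type $\mathrm{VI}_0$ orbit on $\Sigma_+=-1/(2v)$ other than $p_{\mathrm{VI}_0}$ is this whole heteroclinic chain. The $\omega$-limit set of every type $\mathrm{VI}_0$ orbit with $\Sigma_+\neq-1/(2v)$ is contained in $S$. -/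

import Mathlib

open Filter Topology

/-- States `(Σ₊, Σ₋, N₂, N₃)` of the vacuum λ-R Bianchi system with `N₁ = 0`. -/
abbrev State : Type := ℝ × ℝ × ℝ × ℝ

namespace State

abbrev sigmaPlus (p : State) : ℝ := p.1
abbrev sigmaMinus (p : State) : ℝ := p.2.1
abbrev n2 (p : State) : ℝ := p.2.2.1
abbrev n3 (p : State) : ℝ := p.2.2.2

/-- `Σ² = Σ₊² + Σ₋²`. -/
def shearSq (p : State) : ℝ := p.sigmaPlus ^ 2 + p.sigmaMinus ^ 2

/-- The shear variable `Σ₂` in the Misner parametrization (in which `Σ₁ = -2 Σ₊`). -/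
noncomputable def sigma2 (p : State) : ℝ := p.sigmaPlus + √3 * p.sigmaMinus

/-- The shear variable `Σ₃` in the Misner parametrization. -/
noncomputable def sigma3 (p : State) : ℝ := p.sigmaPlus - √3 * p.sigmaMinus

/-- The constraint `1 - Σ² - (N₂ - N₃)² = 0`. -/
def Constraint (p : State) : Prop := 1 - p.shearSq - (p.n2 - p.n3) ^ 2 = 0

end State

/-- The right-hand side of the evolution equations (with respect to the time `τ₋`). -/
noncomputable def vectorField (v : ℝ) (p : State) : State :=
  (2 * (1 - p.shearSq) * (1 + 2 * v * p.sigmaPlus),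
   4 * v * (1 - p.shearSq) * p.sigmaMinus + 2 * √3 * (p.n2 ^ 2 - p.n3 ^ 2),
   -2 * (2 * v * p.shearSq + p.sigmaPlus + √3 * p.sigmaMinus) * p.n2,
   -2 * (2 * v * p.shearSq + p.sigmaPlus - √3 * p.sigmaMinus) * p.n3)

/-- `x` is a solution, defined for all times, that stays in the set `M`. -/
def IsOrbitIn (v : ℝ) (M : Set State) (x : ℝ → State) : Prop :=
  (∀ t, HasDerivAt x (vectorField v (x t)) t) ∧ ∀ t, x t ∈ M

/-- The ω-limit set of a curve: all limit points as `t → +∞`. -/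
def omegaLimitSet (x : ℝ → State) : Set State :=
  omegaLimit atTop (fun (t : ℝ) (_ : Unit) => x t) {()}

/-- The α-limit set of a curve: all limit points as `t → -∞`. -/
def alphaLimitSet (x : ℝ → State) : Set State :=
  omegaLimit atBot (fun (t : ℝ) (_ : Unit) => x t) {()}

/-- The Bianchi type VI₀ state space. -/
def typeVI0 : Set State := {p | p.Constraint ∧ 0 < p.n2 ∧ p.n3 < 0}

/-- The type II₂ part of the boundary of the type VI₀ state space. -/
def typeII2 : Set State := {p | p.Constraint ∧ 0 < p.n2 ∧ p.n3 = 0}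

/-- The type II₃ part of the boundary of the type VI₀ state space. -/
def typeII3 : Set State := {p | p.Constraint ∧ p.n2 = 0 ∧ p.n3 < 0}

/-- The Kasner circle (Bianchi type I). -/
def kasnerCircle : Set State := {p | p.Constraint ∧ p.n2 = 0 ∧ p.n3 = 0}

/-- The closed Kasner arc `A₂`. -/
def arcA2 (v : ℝ) : Set State := {p | p ∈ kasnerCircle ∧ p.sigma2 ≤ -2 * v}

/-- The closed Kasner arc `A₃`. -/
def arcA3 (v : ℝ) : Set State := {p | p ∈ kasnerCircle ∧ p.sigma3 ≤ -2 * v}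

/-- Interior of `A` relative to the Kasner circle. -/
def kasnerInterior (A : Set State) : Set State :=
  {p | p ∈ kasnerCircle ∧ A ∈ 𝓝[kasnerCircle] p}

/-- The stable set `S = K \ int (A₂ ∪ A₃)` of type VI₀. -/
def stableSet (v : ℝ) : Set State := kasnerCircle \ kasnerInterior (arcA2 v ∪ arcA3 v)

/-- The Taub point `T₁`, i.e. `(Σ₁, Σ₂, Σ₃) = (2, -1, -1)`. -/
def taubT1 : State := (-1, 0, 0, 0)

/-- The fixed point `p` of type VI₀ in the supercritical case. -/
noncomputable def fixedPointVI0 (v : ℝ) : State :=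
  (-1 / (2 * v), 0, √(1 - 1 / (4 * v ^ 2)) / 2, -(√(1 - 1 / (4 * v ^ 2)) / 2))

/-- The plane `Σ₊ = -1 / (2v)`. -/
def separatrix (v : ℝ) : Set State := {p | p.sigmaPlus = -1 / (2 * v)}

/-- `C` is a heteroclinic chain of period 2: two distinct Kasner points that are joined, one to
the other and back, by a type II₂ orbit and a type II₃ orbit. -/
def IsPeriodTwoHeteroclinicChain (v : ℝ) (C : Set State) : Prop :=
  ∃ (a b : State) (y z : ℝ → State),
    a ∈ kasnerCircle ∧ b ∈ kasnerCircle ∧ a ≠ b ∧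
    IsOrbitIn v typeII2 y ∧ alphaLimitSet y = {a} ∧ omegaLimitSet y = {b} ∧
    IsOrbitIn v typeII3 z ∧ alphaLimitSet z = {b} ∧ omegaLimitSet z = {a} ∧
    C = {a, b} ∪ Set.range y ∪ Set.range z

/-- The part of the boundary `II₂ ∪ II₃ ∪ K` in the plane `Σ₊ = -1 / (2v)`. -/
def periodTwoCycle (v : ℝ) : Set State :=
  (typeII2 ∪ typeII3 ∪ kasnerCircle) ∩ separatrix v

/-! Everything rests on the offset `w = Σ₊ + 1/(2v)`, which satisfies `w' = 4v(1 - Σ²)w`. Since `1 -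
Σ² = (N₂ - N₃)² ≥ 0`, the sign of `w` is preserved and `|w|` is nondecreasing. As `w` is bounded, it
converges, and Barbalat's lemma gives `w' → 0`. If the limit of `w` is nonzero, then `1 - Σ² → 0`,
so `N₂, N₃ → 0`, `Σ₋²` converges, and the orbit tends to a single Kasner point. There a positive
quantity `N₂` or `-N₃` that tends to zero must have limiting growth rate `≤ 0` forwards and `≥ 0`
backwards in time. These inequalities place the limit in `S`, respectively in `A₂ ∩ A₃`
(`IsOrbitIn.exists_tendsto_stable`, `IsOrbitIn.exists_tendsto_arcs`).

For `v > 1/2` the second key quantity is `P = -N₂N₃`, with `P' = (-8vΣ₋² - 8vΣ₊w)P`. With `c = 4v(1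
- 1/(4v²))`, the logarithmic derivative of `w / (P e^{ct})`, wherever `w ≠ 0`, is `4v(w² + Σ₋²) ≥
0`, so `w` decays like `e^{ct}` backwards in time. Then `log P` is antitone up to an exponentially
small correction and converges as `t → -∞`; Barbalat's lemma yields first `Σ₋ → 0` and then `Σ₋' →
0`, and only the fixed point is compatible with both (`IsOrbitIn.tendsto_fixedPointVI0_atBot`).

On the plane `w = 0`, `P` decreases forwards, and its limit is zero unless the orbit is the fixed
point, where `P` is maximal. Hence limit points lie on the boundary cycle. Conversely, `Σ₋` changes
sign forever; at its upward zeros `Σ₋' ≥ 0` forces `N₂ ≥ -N₃`, and `P → 0` makes these points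
converge to the midpoint of the type II₂ orbit (`IsOrbitIn.mapClusterPt_midpointII2`). Invariance of
limit sets, the reflection symmetry and closedness supply the rest of the cycle. -/

/-! ### Asymptotics of scalar functions -/

/-- **Barbalat's lemma**. -/
theorem tendsto_deriv_zero_atTop {f g : ℝ → ℝ} {l : ℝ} (hf : ∀ t, HasDerivAt f (g t) t)
    (hg : UniformContinuous g) (hl : Tendsto f atTop (𝓝 l)) : Tendsto g atTop (𝓝 0) := by
  rw [Metric.tendsto_atTop]
  intro ε hε
  obtain ⟨δ, hδ, h⟩ := Metric.uniformContinuous_iff.1 hg (ε / 2) (by positivity)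
  -- On a window of length `δ / 2` the slope of `f` is then at most `2 (ε δ / 16) / (δ / 2) = ε /
  -- 4`; the mean value theorem transfers this to some `g c`, and uniform continuity costs another
  -- `ε / 2`.
  obtain ⟨T, hT⟩ := Metric.tendsto_atTop.1 hl (ε * δ / 16) (by positivity)
  refine ⟨T, fun t ht => ?_⟩
  obtain ⟨c, hc, hcd⟩ := exists_hasDerivAt_eq_slope f g (show t < t + δ / 2 by linarith)
    (fun s _ => (hf s).continuousAt.continuousWithinAt) (fun s _ => hf s)
  have h1 := hT t ht
  have h2 := hT (t + δ / 2) (by linarith)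
  rw [Real.dist_eq] at h1 h2
  have h3 : |g c| ≤ ε / 4 := by
    rw [hcd, add_sub_cancel_left, abs_div, abs_of_pos (show 0 < δ / 2 by linarith),
      div_le_iff₀ (by linarith)]
    have := abs_sub_le (f (t + δ / 2)) l (f t)
    rw [abs_sub_comm l] at this
    linarith
  have h4 : dist (g t) (g c) < ε / 2 := by
    apply h
    rw [Real.dist_eq, abs_lt]
    constructor <;> linarith [hc.1, hc.2]
  rw [Real.dist_eq] at h4
  rw [Real.dist_eq, sub_zero]
  have := abs_sub_abs_le_abs_sub (g t) (g c)
  linarith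

theorem hasDerivAt_comp_neg {f g : ℝ → ℝ} (hf : ∀ t, HasDerivAt f (g t) t) (t : ℝ) :
    HasDerivAt (fun s => f (-s)) (-g (-t)) t := by
  simpa [Function.comp_def] using (hf (-t)).comp t (hasDerivAt_neg t)

/-- **Barbalat's lemma**, backwards in time. -/
theorem tendsto_deriv_zero_atBot {f g : ℝ → ℝ} {l : ℝ} (hf : ∀ t, HasDerivAt f (g t) t)
    (hg : UniformContinuous g) (hl : Tendsto f atBot (𝓝 l)) : Tendsto g atBot (𝓝 0) := by
  have := (tendsto_deriv_zero_atTop (hasDerivAt_comp_neg hf)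
    ((hg.comp uniformContinuous_neg).neg) (hl.comp tendsto_neg_atTop_atBot)).neg.comp
      tendsto_neg_atBot_atTop
  simpa [Function.comp_def] using this

/-- Away from the trivial case `c = 0`, `f` is eventually nonzero, so by the intermediate value
theorem its sign is eventually constant. -/
theorem Continuous.exists_tendsto_of_sq_atTop {f : ℝ → ℝ} {c : ℝ} (hf : Continuous f)
    (h : Tendsto (fun t => f t ^ 2) atTop (𝓝 (c ^ 2))) :
    ∃ d, d ^ 2 = c ^ 2 ∧ Tendsto f atTop (𝓝 d) := by
  have habs : Tendsto (fun t => |f t|) atTop (𝓝 |c|) := by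
    have := (Real.continuous_sqrt.tendsto _).comp h
    simpa [Function.comp_def, Real.sqrt_sq_eq_abs] using this
  by_cases hc : c = 0
  · refine ⟨0, by simp [hc], ?_⟩
    rw [hc, abs_zero] at habs
    exact (tendsto_zero_iff_abs_tendsto_zero f).2 habs
  obtain ⟨T, hT⟩ := eventually_atTop.1 (habs.eventually_ne (abs_ne_zero.2 hc))
  have hne : ∀ t ∈ Set.Ici T, f t ≠ 0 := fun t ht h0 => hT t ht (by simp [h0])
  have hsgn : (∀ t ∈ Set.Ici T, 0 < f t) ∨ (∀ t ∈ Set.Ici T, f t < 0) := by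
    by_contra hcon
    push Not at hcon
    obtain ⟨⟨s, hs, hs'⟩, t, ht, ht'⟩ := hcon
    obtain ⟨r, hr, hr0⟩ := (isPreconnected_Ici (a := T)).intermediate_value hs ht
      hf.continuousOn ⟨hs', ht'⟩
    exact hne r hr hr0
  rcases hsgn with h | h
  · refine ⟨|c|, sq_abs c, habs.congr' ?_⟩
    filter_upwards [eventually_ge_atTop T] with t ht using abs_of_pos (h t ht)
  · refine ⟨-|c|, by simp, habs.neg.congr' ?_⟩
    filter_upwards [eventually_ge_atTop T] with t ht
    rw [abs_of_neg (h t ht), neg_neg]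

theorem Continuous.exists_tendsto_of_sq_atBot {f : ℝ → ℝ} {c : ℝ} (hf : Continuous f)
    (h : Tendsto (fun t => f t ^ 2) atBot (𝓝 (c ^ 2))) :
    ∃ d, d ^ 2 = c ^ 2 ∧ Tendsto f atBot (𝓝 d) := by
  obtain ⟨d, hd, hd'⟩ := (hf.comp continuous_neg).exists_tendsto_of_sq_atTop
    (h.comp tendsto_neg_atTop_atBot)
  refine ⟨d, hd, ?_⟩
  simpa [Function.comp_def] using hd'.comp tendsto_neg_atBot_atTop

/-- A solution of a scalar linear homogeneous equation is an exponential. -/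
theorem eq_mul_exp_of_hasDerivAt_mul {f r : ℝ → ℝ} (hr : Continuous r)
    (hf : ∀ t, HasDerivAt f (r t * f t) t) (t : ℝ) :
    f t = f 0 * Real.exp (∫ s in (0 : ℝ)..t, r s) := by
  have hR : ∀ t, HasDerivAt (fun t => ∫ s in (0 : ℝ)..t, r s) (r t) t := fun t =>
    intervalIntegral.integral_hasDerivAt_right (hr.intervalIntegrable _ _)
      (hr.stronglyMeasurableAtFilter _ _) hr.continuousAt
  have h0 : ∀ t, HasDerivAt (fun t => f t * Real.exp (-∫ s in (0 : ℝ)..t, r s)) 0 t := fun t => by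
    refine ((hf t).mul ((hR t).neg.exp)).congr_deriv ?_
    ring
  have := is_const_of_deriv_eq_zero (fun t => (h0 t).differentiableAt) (fun t => (h0 t).deriv) t 0
  simp only [intervalIntegral.integral_same, neg_zero, Real.exp_zero, mul_one] at this
  rw [← this, mul_assoc, ← Real.exp_add]
  simp

/-- A positive solution of `f' = r f` that tends to zero has a nonpositive limiting rate. -/
theorem rate_nonpos_of_tendsto_zero_atTop {f r : ℝ → ℝ} {ρ : ℝ} (hpos : ∀ t, 0 < f t)
    (hf : ∀ t, HasDerivAt f (r t * f t) t) (hr : Tendsto r atTop (𝓝 ρ))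
    (h0 : Tendsto f atTop (𝓝 0)) : ρ ≤ 0 := by
  by_contra! h
  obtain ⟨T, hT⟩ := eventually_atTop.1 (hr.eventually (lt_mem_nhds h))
  have hm : MonotoneOn f (Set.Ici T) := by
    apply monotoneOn_of_deriv_nonneg (convex_Ici T)
      (fun t _ => (hf t).continuousAt.continuousWithinAt)
      (fun t _ => (hf t).differentiableAt.differentiableWithinAt)
    intro t ht
    rw [interior_Ici] at ht
    rw [(hf t).deriv]
    exact mul_nonneg (hT t ht.le).le (hpos t).le
  have : f T ≤ 0 := ge_of_tendsto h0 (by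
    filter_upwards [eventually_ge_atTop T] with t ht using hm Set.self_mem_Ici ht ht)
  linarith [hpos T]

/-- A positive solution of `f' = r f` that tends to zero backwards in time has a nonnegative
limiting rate. -/
theorem rate_nonneg_of_tendsto_zero_atBot {f r : ℝ → ℝ} {ρ : ℝ} (hpos : ∀ t, 0 < f t)
    (hf : ∀ t, HasDerivAt f (r t * f t) t) (hr : Tendsto r atBot (𝓝 ρ))
    (h0 : Tendsto f atBot (𝓝 0)) : 0 ≤ ρ := by
  have := rate_nonpos_of_tendsto_zero_atTop (f := fun t => f (-t)) (r := fun t => -r (-t))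
    (ρ := -ρ) (fun t => hpos _) (fun t => by simpa using hasDerivAt_comp_neg hf t)
    (hr.comp tendsto_neg_atTop_atBot).neg (h0.comp tendsto_neg_atTop_atBot)
  linarith

theorem Monotone.exists_tendsto_atTop {f : ℝ → ℝ} {C : ℝ} (hf : Monotone f) (hC : ∀ t, f t ≤ C) :
    ∃ l, Tendsto f atTop (𝓝 l) ∧ ∀ t, f t ≤ l := by
  have hb : BddAbove (Set.range f) := ⟨C, by rintro _ ⟨t, rfl⟩; exact hC t⟩
  exact ⟨_, tendsto_atTop_ciSup hf hb, fun t => le_ciSup hb t⟩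

theorem Monotone.exists_tendsto_atBot {f : ℝ → ℝ} {C : ℝ} (hf : Monotone f) (hC : ∀ t, C ≤ f t) :
    ∃ l, Tendsto f atBot (𝓝 l) ∧ ∀ t, l ≤ f t := by
  have hb : BddBelow (Set.range f) := ⟨C, by rintro _ ⟨t, rfl⟩; exact hC t⟩
  exact ⟨_, tendsto_atBot_ciInf hf hb, fun t => ciInf_le hb t⟩

theorem Antitone.exists_tendsto_atTop {f : ℝ → ℝ} {C : ℝ} (hf : Antitone f) (hC : ∀ t, C ≤ f t) :
    ∃ l, Tendsto f atTop (𝓝 l) ∧ ∀ t, l ≤ f t := by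
  have hb : BddBelow (Set.range f) := ⟨C, by rintro _ ⟨t, rfl⟩; exact hC t⟩
  exact ⟨_, tendsto_atTop_ciInf hf hb, fun t => ciInf_le hb t⟩

/-! ### Global existence and continuous dependence -/

section ODE

variable {E : Type*} [NormedAddCommGroup E] [NormedSpace ℝ E]

/-- Global existence for a bounded Lipschitz vector field. -/
theorem LipschitzWith.exists_forall_hasDerivAt [CompleteSpace E] {f : E → E} {K L : NNReal}
    (hf : LipschitzWith K f) (hL : ∀ x, ‖f x‖ ≤ L) (p : E) :
    ∃ x : ℝ → E, x 0 = p ∧ ∀ t, HasDerivAt x (f (x t)) t := by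
  have hloc : ∀ T : ℝ, 0 < T → ∃ α : ℝ → E, α 0 = p ∧
      ∀ t ∈ Set.Ioo (-T) T, HasDerivAt α (f (α t)) t := by
    intro T hT
    -- The ball has radius `L T`, which a solution of speed at most `L` cannot leave within time
    -- `T`; hence the interval is arbitrary.
    have hpl : IsPicardLindelof (fun _ : ℝ => f)
        (⟨0, ⟨by linarith, hT.le⟩⟩ : Set.Icc (-T) T) p (L * ⟨T, hT.le⟩) 0 L K :=
      { lipschitzOnWith := fun _ _ => hf.lipschitzOnWith
        continuousOn := fun _ _ => continuousOn_const
        norm_le := fun _ _ x _ => hL x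
        mul_max_le := by simp; exact le_rfl }
    obtain ⟨α, h0, hα⟩ := hpl.exists_eq_forall_mem_Icc_hasDerivWithinAt₀
    exact ⟨α, h0, fun t ht =>
      (hα t (Set.Ioo_subset_Icc_self ht)).hasDerivAt (Icc_mem_nhds ht.1 ht.2)⟩
  choose! α h0 hα using hloc
  have heq : ∀ S T : ℝ, 0 < S → S ≤ T → Set.EqOn (α S) (α T) (Set.Ioo (-S) S) := by
    intro S T hS hST
    apply ODE_solution_unique_of_mem_Ioo (v := fun _ => f) (s := fun _ => Set.univ) (K := K)
      (t₀ := 0) (fun _ _ => hf.lipschitzOnWith) ⟨by linarith, hS⟩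
    · exact fun t ht => ⟨hα S hS t ht, trivial⟩
    · exact fun t ht => ⟨hα T (by linarith) t ⟨by linarith [ht.1], by linarith [ht.2]⟩, trivial⟩
    · rw [h0 S hS, h0 T (by linarith)]
  -- The local solutions agree on common intervals; the margin `1` puts `t` in the open interval on
  -- which `α (|t| + 1)` solves the equation.
  refine ⟨fun t => α (|t| + 1) t, h0 _ (by positivity), fun t => ?_⟩
  have hmem : t ∈ Set.Ioo (-(|t| + 1)) (|t| + 1) :=
    ⟨by linarith [neg_abs_le t], by linarith [le_abs_self t]⟩
  refine (hα _ (by positivity) t hmem).congr_of_eventuallyEq ?_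
  filter_upwards [Ioo_mem_nhds hmem.1 hmem.2] with s hs
  rcases le_total (|s| + 1) (|t| + 1) with h | h
  · exact heq _ _ (by positivity) h ⟨by linarith [neg_abs_le s], by linarith [le_abs_self s]⟩
  · exact (heq _ _ (by positivity) h hs).symm

/-- Solutions depend continuously on their initial values. -/
theorem LipschitzWith.dist_le_of_hasDerivAt {f : E → E} {K : NNReal} (hf : LipschitzWith K f)
    {x y : ℝ → E} (hx : ∀ t, HasDerivAt x (f (x t)) t) (hy : ∀ t, HasDerivAt y (f (y t)) t)
    (s t : ℝ) : dist (x (s + t)) (y t) ≤ dist (x s) (y 0) * Real.exp (K * |t|) := by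
  have key : ∀ {f : E → E} {x y : ℝ → E}, LipschitzWith K f → (∀ t, HasDerivAt x (f (x t)) t) →
      (∀ t, HasDerivAt y (f (y t)) t) → ∀ t, 0 ≤ t →
      dist (x t) (y t) ≤ dist (x 0) (y 0) * Real.exp (K * t) := by
    intro f x y hf hx hy t ht
    have := dist_le_of_trajectories_ODE (v := fun _ => f) (a := 0) (b := t) (fun _ => hf)
      (fun s _ => (hx s).continuousAt.continuousWithinAt) (fun s _ => (hx s).hasDerivWithinAt)
      (fun s _ => (hy s).continuousAt.continuousWithinAt) (fun s _ => (hy s).hasDerivWithinAt)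
      le_rfl t ⟨ht, le_rfl⟩
    simpa using this
  have hxs : ∀ t, HasDerivAt (fun t => x (s + t)) (f (x (s + t))) t := fun t =>
    (hx (s + t)).comp_const_add s t
  rcases le_total 0 t with ht | ht
  · simpa [abs_of_nonneg ht] using key hf hxs hy t ht
  · have hneg : ∀ {z : ℝ → E}, (∀ t, HasDerivAt z (f (z t)) t) →
        ∀ t, HasDerivAt (fun t => z (-t)) (-f (z (-t))) t := fun {z} hz t => by
      simpa [Function.comp_def] using (hz (-t)).scomp t (hasDerivAt_neg t)
    have := key (f := fun p => -f p) (fun p q => by simpa using hf p q)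
      (hneg hxs) (hneg hy) (-t) (by linarith)
    simpa [abs_of_nonpos ht] using this

end ODE

/-! ### The flow on the compact state space -/

/-- The type VI₀ state space together with its boundary. -/
def closedVI0 : Set State := {p | p.Constraint ∧ 0 ≤ p.n2 ∧ p.n3 ≤ 0}

theorem typeVI0_subset : typeVI0 ⊆ closedVI0 := fun _ h => ⟨h.1, h.2.1.le, h.2.2.le⟩
theorem typeII2_subset : typeII2 ⊆ closedVI0 := fun _ h => ⟨h.1, h.2.1.le, h.2.2.le⟩
theorem typeII3_subset : typeII3 ⊆ closedVI0 := fun _ h => ⟨h.1, h.2.1.ge, h.2.2.le⟩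

theorem IsOrbitIn.mono {v : ℝ} {M N : Set State} {x : ℝ → State} (h : IsOrbitIn v M x)
    (hMN : M ⊆ N) : IsOrbitIn v N x := ⟨h.1, fun t => hMN (h.2 t)⟩

theorem closedVI0_subset_closedBall : closedVI0 ⊆ Metric.closedBall 0 1 := by
  rintro ⟨X, Y, a, b⟩ ⟨hC, ha, hb⟩
  simp only [State.Constraint, State.shearSq] at hC ha hb
  rw [mem_closedBall_zero_iff]
  simp only [Prod.norm_mk, Real.norm_eq_abs, sup_le_iff, abs_le]
  refine ⟨⟨?_, ?_⟩, ⟨?_, ?_⟩, ⟨?_, ?_⟩, ?_, ?_⟩ <;>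
    nlinarith [sq_nonneg X, sq_nonneg Y, sq_nonneg (a - b), sq_nonneg a, sq_nonneg b,
      mul_nonneg ha (neg_nonneg.2 hb)]

theorem contDiff_vectorField (v : ℝ) : ContDiff ℝ 1 (vectorField v) := by
  unfold vectorField State.shearSq
  fun_prop

/-- A smooth cutoff that equals one on the unit ball of the state variables. -/
noncomputable def cutoff : ContDiffBump (0 : State) := ⟨1, 2, one_pos, one_lt_two⟩

/-- The polynomial field is not globally Lipschitz. Its product with a bump function is `C¹` with
compact support, hence Lipschitz and bounded, and agrees with the field on the state space. -/
theorem exists_truncated_lipschitz (v : ℝ) : ∃ K L : NNReal,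
    LipschitzWith K (fun p => cutoff p • vectorField v p) ∧
      ∀ p, ‖cutoff p • vectorField v p‖ ≤ L := by
  have hc : HasCompactSupport (fun p => cutoff p • vectorField v p) :=
    cutoff.hasCompactSupport.smul_right
  have hd : ContDiff ℝ 1 (fun p => cutoff p • vectorField v p) :=
    cutoff.contDiff.smul (contDiff_vectorField v)
  obtain ⟨K, hK⟩ := hd.lipschitzWith_of_hasCompactSupport hc one_ne_zero
  obtain ⟨L, hL⟩ := hc.exists_bound_of_continuous hd.continuous
  exact ⟨K, ⟨L, (norm_nonneg _).trans (hL 0)⟩, hK, hL⟩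

theorem cutoff_eq_one {p : State} (hp : p ∈ closedVI0) : cutoff p = 1 :=
  cutoff.one_of_mem_closedBall (closedVI0_subset_closedBall hp)

section Components

variable {x : ℝ → State} {w : State} {t : ℝ}

theorem HasDerivAt.sigmaPlus (h : HasDerivAt x w t) :
    HasDerivAt (fun t => (x t).sigmaPlus) w.sigmaPlus t :=
  h.fst

theorem HasDerivAt.sigmaMinus (h : HasDerivAt x w t) :
    HasDerivAt (fun t => (x t).sigmaMinus) w.sigmaMinus t :=
  h.snd.fst

theorem HasDerivAt.n2 (h : HasDerivAt x w t) : HasDerivAt (fun t => (x t).n2) w.n2 t :=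
  h.snd.snd.fst

theorem HasDerivAt.n3 (h : HasDerivAt x w t) : HasDerivAt (fun t => (x t).n3) w.n3 t :=
  h.snd.snd.snd

end Components

@[fun_prop]
theorem continuous_shearSq : Continuous State.shearSq := by
  unfold State.shearSq
  fun_prop

/-- Along the truncated flow the constraint function, `N₂` and `N₃` each solve a homogeneous linear
equation, so the constraint and the signs persist. The solution therefore stays where the cutoff is
one and solves the original system. The positive factors `c` preserve vanishing as well as strict
signs, so the result serves both type VI₀ and type II. -/
theorem exists_orbit (v : ℝ) {p : State} (hp : p ∈ closedVI0) :
    ∃ x : ℝ → State, x 0 = p ∧ IsOrbitIn v closedVI0 x ∧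
      ∀ t, (∃ c > 0, (x t).n2 = p.n2 * c) ∧ ∃ c > 0, (x t).n3 = p.n3 * c := by
  obtain ⟨K, L, hK, hL⟩ := exists_truncated_lipschitz v
  obtain ⟨x, h0, hx⟩ := hK.exists_forall_hasDerivAt hL p
  have hxc : Continuous x := continuous_iff_continuousAt.2 fun t => (hx t).continuousAt
  have hχ : Continuous fun t => cutoff (x t) := cutoff.continuous.comp hxc
  have hC := eq_mul_exp_of_hasDerivAt_mul
    (f := fun t => 1 - (x t).shearSq - ((x t).n2 - (x t).n3) ^ 2)
    (r := fun t => cutoff (x t) * (-4 * (2 * v * (x t).shearSq + (x t).sigmaPlus)))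
    (by fun_prop) (fun t => by
      have := (((((hx t).sigmaPlus.pow 2).add ((hx t).sigmaMinus.pow 2)).const_sub 1).sub
        (((hx t).n2.sub (hx t).n3).pow 2))
      refine this.congr_deriv ?_
      simp [vectorField, State.shearSq]
      ring)
  have h2 := eq_mul_exp_of_hasDerivAt_mul (f := fun t => (x t).n2)
    (r := fun t => cutoff (x t) *
      (-2 * (2 * v * (x t).shearSq + (x t).sigmaPlus + √3 * (x t).sigmaMinus)))
    (by fun_prop) (fun t => (hx t).n2.congr_deriv (by simp [vectorField]; ring))
  have h3 := eq_mul_exp_of_hasDerivAt_mul (f := fun t => (x t).n3)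
    (r := fun t => cutoff (x t) *
      (-2 * (2 * v * (x t).shearSq + (x t).sigmaPlus - √3 * (x t).sigmaMinus)))
    (by fun_prop) (fun t => (hx t).n3.congr_deriv (by simp [vectorField]; ring))
  simp only [h0] at hC h2 h3
  have hmem : ∀ t, x t ∈ closedVI0 := fun t => by
    refine ⟨?_, ?_, ?_⟩
    · have := hp.1
      unfold State.Constraint at this ⊢
      rw [hC, this, zero_mul]
    · rw [h2]; exact mul_nonneg hp.2.1 (Real.exp_pos _).le
    · rw [h3]; exact mul_nonpos_of_nonpos_of_nonneg hp.2.2 (Real.exp_pos _).le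
  refine ⟨x, h0, ⟨fun t => ?_, hmem⟩, fun t => ⟨⟨_, Real.exp_pos _, h2 t⟩, _, Real.exp_pos _, h3 t⟩⟩
  have := hx t
  rwa [cutoff_eq_one (hmem t), one_smul] at this

section Orbit

variable {v : ℝ} {x y : ℝ → State}

theorem IsOrbitIn.exists_dist_le (hx : IsOrbitIn v closedVI0 x) (hy : IsOrbitIn v closedVI0 y) :
    ∃ K : ℝ, ∀ s t, dist (x (s + t)) (y t) ≤ dist (x s) (y 0) * Real.exp (K * |t|) := by
  obtain ⟨K, L, hK, hL⟩ := exists_truncated_lipschitz v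
  refine ⟨K, fun s t => hK.dist_le_of_hasDerivAt (fun t => ?_) (fun t => ?_) s t⟩
  · rw [cutoff_eq_one (hx.2 t), one_smul]; exact hx.1 t
  · rw [cutoff_eq_one (hy.2 t), one_smul]; exact hy.1 t

theorem IsOrbitIn.eq_of_zero (hx : IsOrbitIn v closedVI0 x) (hy : IsOrbitIn v closedVI0 y)
    (h : x 0 = y 0) : x = y := by
  obtain ⟨K, hK⟩ := hx.exists_dist_le hy
  funext t
  have := hK 0 t
  rwa [h, dist_self, zero_mul, zero_add, dist_le_zero] at this

theorem existsUnique_orbit_typeVI0 (v : ℝ) {p : State} (hp : p ∈ typeVI0) :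
    ∃! x : ℝ → State, IsOrbitIn v typeVI0 x ∧ x 0 = p := by
  obtain ⟨x, h0, hx, hs⟩ := exists_orbit v (typeVI0_subset hp)
  refine ⟨x, ⟨⟨hx.1, fun t => ⟨(hx.2 t).1, ?_, ?_⟩⟩, h0⟩, ?_⟩
  · obtain ⟨c, hc, h⟩ := (hs t).1
    rw [h]; exact mul_pos hp.2.1 hc
  · obtain ⟨c, hc, h⟩ := (hs t).2
    rw [h]; exact mul_neg_of_neg_of_pos hp.2.2 hc
  · rintro y ⟨hy, hy0⟩
    exact (hy.mono typeVI0_subset).eq_of_zero hx (hy0.trans h0.symm)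

theorem IsOrbitIn.continuous {M : Set State} (hx : IsOrbitIn v M x) : Continuous x :=
  continuous_iff_continuousAt.2 fun t => (hx.1 t).continuousAt

theorem IsOrbitIn.uniformContinuous (hx : IsOrbitIn v closedVI0 x) : UniformContinuous x := by
  obtain ⟨K, L, hK, hL⟩ := exists_truncated_lipschitz v
  refine (lipschitzWith_of_nnnorm_deriv_le (C := L) (fun t => (hx.1 t).differentiableAt)
    fun t => ?_).uniformContinuous
  have := hL (x t)
  rw [cutoff_eq_one (hx.2 t), one_smul] at this
  rw [(hx.1 t).deriv]
  exact this

theorem IsOrbitIn.uniformContinuous_comp (hx : IsOrbitIn v closedVI0 x) {φ : State → ℝ}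
    (hφ : Continuous φ) : UniformContinuous fun t => φ (x t) := by
  have h := (isCompact_closedBall (0 : State) 1).uniformContinuousOn_of_continuous
    hφ.continuousOn
  have := h.comp hx.uniformContinuous.uniformContinuousOn (s := Set.univ)
    (fun t _ => closedVI0_subset_closedBall (hx.2 t))
  exact uniformContinuousOn_univ.1 this

/-- The constraint solved for `1 - Σ²`. -/
theorem State.Constraint.one_sub_shearSq {p : State} (hp : p.Constraint) :
    1 - p.shearSq = (p.n2 - p.n3) ^ 2 := by
  unfold State.Constraint at hp
  linarith

theorem mem_omegaLimitSet {q : State} : q ∈ omegaLimitSet x ↔ MapClusterPt q atTop x :=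
  mem_omegaLimit_singleton_iff_mapClusterPt _ _ _ _

theorem mem_alphaLimitSet {q : State} : q ∈ alphaLimitSet x ↔ MapClusterPt q atBot x :=
  mem_omegaLimit_singleton_iff_mapClusterPt _ _ _ _

theorem MapClusterPt.eq_of_tendsto {α β : Type*} [TopologicalSpace β] [T2Space β] {l : Filter α}
    {f : α → β} {p q : β} (hq : MapClusterPt q l f) (hp : Tendsto f l (𝓝 p)) : q = p := by
  have : (𝓝 q ⊓ 𝓝 p).NeBot := Filter.NeBot.mono hq (inf_le_inf_left _ hp)
  exact eq_of_nhds_neBot this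

theorem omegaLimitSet_eq_singleton {p : State} (h : Tendsto x atTop (𝓝 p)) :
    omegaLimitSet x = {p} := by
  ext q
  rw [mem_omegaLimitSet, Set.mem_singleton_iff]
  exact ⟨fun hq => hq.eq_of_tendsto h, fun hq => hq ▸ h.mapClusterPt⟩

theorem alphaLimitSet_eq_singleton {p : State} (h : Tendsto x atBot (𝓝 p)) :
    alphaLimitSet x = {p} := by
  ext q
  rw [mem_alphaLimitSet, Set.mem_singleton_iff]
  exact ⟨fun hq => hq.eq_of_tendsto h, fun hq => hq ▸ h.mapClusterPt⟩

end Orbit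

/-! ### Convergence to Kasner points and the stable set -/

section Kasner

variable {v : ℝ} {x : ℝ → State}

theorem mem_kasnerCircle_iff {p : State} :
    p ∈ kasnerCircle ↔ p.shearSq = 1 ∧ p.n2 = 0 ∧ p.n3 = 0 := by
  constructor
  · rintro ⟨hC, h2, h3⟩
    have := hC.one_sub_shearSq
    rw [h2, h3] at this
    exact ⟨by linarith, h2, h3⟩
  · rintro ⟨hC, h2, h3⟩
    refine ⟨?_, h2, h3⟩
    rw [State.Constraint, hC, h2, h3]
    norm_num

theorem State.tendsto_of_components {ι : Type*} {l : Filter ι} {x : ι → State} {p : State}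
    (h1 : Tendsto (fun t => (x t).sigmaPlus) l (𝓝 p.sigmaPlus))
    (h2 : Tendsto (fun t => (x t).sigmaMinus) l (𝓝 p.sigmaMinus))
    (h3 : Tendsto (fun t => (x t).n2) l (𝓝 p.n2))
    (h4 : Tendsto (fun t => (x t).n3) l (𝓝 p.n3)) : Tendsto x l (𝓝 p) :=
  h1.prodMk_nhds (h2.prodMk_nhds (h3.prodMk_nhds h4))

theorem tendsto_n2_n3_zero {ι : Type*} {l : Filter ι} {x : ι → State}
    (hx : ∀ t, x t ∈ closedVI0)
    (hu : Tendsto (fun t => 1 - (x t).shearSq) l (𝓝 0)) :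
    Tendsto (fun t => (x t).n2) l (𝓝 0) ∧ Tendsto (fun t => (x t).n3) l (𝓝 0) := by
  have h : Tendsto (fun t => (x t).n2 - (x t).n3) l (𝓝 0) := by
    have := (Real.continuous_sqrt.tendsto _).comp hu
    rw [Real.sqrt_zero] at this
    refine this.congr fun t => ?_
    rw [Function.comp_apply, (hx t).1.one_sub_shearSq, Real.sqrt_sq]
    linarith [(hx t).2.1, (hx t).2.2]
  constructor
  · exact squeeze_zero (fun t => (hx t).2.1) (fun t => by linarith [(hx t).2.2]) h
  · have := squeeze_zero (fun t => neg_nonneg.2 (hx t).2.2)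
      (fun t => show _ ≤ (x t).n2 - (x t).n3 by linarith [(hx t).2.1]) h
    simpa using this.neg

theorem tendsto_sigmaMinus_sq {ι : Type*} {l : Filter ι} {x : ι → State} {ξ : ℝ}
    (hX : Tendsto (fun t => (x t).sigmaPlus) l (𝓝 ξ))
    (hu : Tendsto (fun t => 1 - (x t).shearSq) l (𝓝 0)) :
    Tendsto (fun t => (x t).sigmaMinus ^ 2) l (𝓝 (1 - ξ ^ 2)) := by
  have := ((tendsto_const_nhds (x := (1 : ℝ))).sub hu).sub (hX.pow 2)
  rw [sub_zero] at this
  refine this.congr fun t => ?_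
  simp only [State.shearSq]
  ring

theorem one_sub_sq_nonneg_of_tendsto {ι : Type*} {l : Filter ι} [l.NeBot] {x : ι → State} {ξ : ℝ}
    (hX : Tendsto (fun t => (x t).sigmaPlus) l (𝓝 ξ))
    (hu : Tendsto (fun t => 1 - (x t).shearSq) l (𝓝 0)) : 0 ≤ 1 - ξ ^ 2 :=
  ge_of_tendsto' (tendsto_sigmaMinus_sq hX hu) fun _ => sq_nonneg _

theorem mem_kasnerCircle_of_sq {ξ d : ℝ} (h : d ^ 2 = 1 - ξ ^ 2) :
    ((ξ, d, 0, 0) : State) ∈ kasnerCircle := by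
  rw [mem_kasnerCircle_iff]
  simp [State.shearSq, h]

/-- The limits of `Σ₊` and `1 - Σ²` determine that of `Σ₋²`; continuity selects one root, and the
constraint forces `N₂, N₃ → 0`. -/
theorem IsOrbitIn.tendsto_kasner_atTop (hx : IsOrbitIn v closedVI0 x) {ξ : ℝ}
    (hX : Tendsto (fun t => (x t).sigmaPlus) atTop (𝓝 ξ))
    (hu : Tendsto (fun t => 1 - (x t).shearSq) atTop (𝓝 0)) :
    ∃ p ∈ kasnerCircle, p.sigmaPlus = ξ ∧ Tendsto x atTop (𝓝 p) := by
  have hY := tendsto_sigmaMinus_sq hX hu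
  rw [← Real.sq_sqrt (one_sub_sq_nonneg_of_tendsto hX hu)] at hY
  have hxc := hx.continuous
  obtain ⟨d, hd, hd'⟩ := Continuous.exists_tendsto_of_sq_atTop (by fun_prop) hY
  rw [Real.sq_sqrt (one_sub_sq_nonneg_of_tendsto hX hu)] at hd
  obtain ⟨h2, h3⟩ := tendsto_n2_n3_zero hx.2 hu
  exact ⟨_, mem_kasnerCircle_of_sq hd, rfl, State.tendsto_of_components hX hd' h2 h3⟩

theorem IsOrbitIn.tendsto_kasner_atBot (hx : IsOrbitIn v closedVI0 x) {ξ : ℝ}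
    (hX : Tendsto (fun t => (x t).sigmaPlus) atBot (𝓝 ξ))
    (hu : Tendsto (fun t => 1 - (x t).shearSq) atBot (𝓝 0)) :
    ∃ p ∈ kasnerCircle, p.sigmaPlus = ξ ∧ Tendsto x atBot (𝓝 p) := by
  have hY := tendsto_sigmaMinus_sq hX hu
  rw [← Real.sq_sqrt (one_sub_sq_nonneg_of_tendsto hX hu)] at hY
  have hxc := hx.continuous
  obtain ⟨d, hd, hd'⟩ := Continuous.exists_tendsto_of_sq_atBot (by fun_prop) hY
  rw [Real.sq_sqrt (one_sub_sq_nonneg_of_tendsto hX hu)] at hd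
  obtain ⟨h2, h3⟩ := tendsto_n2_n3_zero hx.2 hu
  exact ⟨_, mem_kasnerCircle_of_sq hd, rfl, State.tendsto_of_components hX hd' h2 h3⟩

/-- Growth rate of `N₂`. -/
noncomputable def rate2 (v : ℝ) (p : State) : ℝ := -2 * (2 * v * p.shearSq + p.sigma2)

/-- Growth rate of `N₃`. -/
noncomputable def rate3 (v : ℝ) (p : State) : ℝ := -2 * (2 * v * p.shearSq + p.sigma3)

@[fun_prop]
theorem continuous_sigma2 : Continuous State.sigma2 := by unfold State.sigma2; fun_prop

@[fun_prop]
theorem continuous_sigma3 : Continuous State.sigma3 := by unfold State.sigma3; fun_prop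

theorem continuous_rate2 : Continuous (rate2 v) := by unfold rate2; fun_prop

theorem continuous_rate3 : Continuous (rate3 v) := by unfold rate3; fun_prop

theorem IsOrbitIn.hasDerivAt_n2 {M : Set State} (hx : IsOrbitIn v M x) (t : ℝ) :
    HasDerivAt (fun t => (x t).n2) (rate2 v (x t) * (x t).n2) t :=
  (hx.1 t).n2.congr_deriv (by simp [vectorField, rate2, State.sigma2]; ring)

theorem IsOrbitIn.hasDerivAt_n3 {M : Set State} (hx : IsOrbitIn v M x) (t : ℝ) :
    HasDerivAt (fun t => (x t).n3) (rate3 v (x t) * (x t).n3) t :=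
  (hx.1 t).n3.congr_deriv (by simp [vectorField, rate3, State.sigma3]; ring)

theorem IsOrbitIn.hasDerivAt_neg_n3 {M : Set State} (hx : IsOrbitIn v M x) (t : ℝ) :
    HasDerivAt (fun t => -(x t).n3) (rate3 v (x t) * -(x t).n3) t :=
  (hx.hasDerivAt_n3 t).neg.congr_deriv (by ring)

/-- On the Kasner circle the growth rates of `N₂` and `-N₃` are `-2(2v + Σ₂)` and `-2(2v + Σ₃)`;
neither can be positive when the corresponding quantity decays to zero. -/
theorem IsOrbitIn.sigma_ge_of_tendsto_atTop (hx : IsOrbitIn v typeVI0 x) {p : State}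
    (hp : p ∈ kasnerCircle) (h : Tendsto x atTop (𝓝 p)) :
    -2 * v ≤ p.sigma2 ∧ -2 * v ≤ p.sigma3 := by
  obtain ⟨hs, h2, h3⟩ := mem_kasnerCircle_iff.1 hp
  constructor
  · have := rate_nonpos_of_tendsto_zero_atTop (fun t => (hx.2 t).2.1) hx.hasDerivAt_n2
      ((continuous_rate2.tendsto p).comp h) (h2 ▸ h.snd_nhds.snd_nhds.fst_nhds)
    rw [rate2, hs] at this
    linarith
  · have := rate_nonpos_of_tendsto_zero_atTop (fun t => neg_pos.2 (hx.2 t).2.2)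
      hx.hasDerivAt_neg_n3 ((continuous_rate3.tendsto p).comp h)
      (by simpa [show p.2.2.2 = 0 from h3] using h.snd_nhds.snd_nhds.snd_nhds.neg)
    rw [rate3, hs] at this
    linarith

theorem IsOrbitIn.sigma_le_of_tendsto_atBot (hx : IsOrbitIn v typeVI0 x) {p : State}
    (hp : p ∈ kasnerCircle) (h : Tendsto x atBot (𝓝 p)) :
    p.sigma2 ≤ -2 * v ∧ p.sigma3 ≤ -2 * v := by
  obtain ⟨hs, h2, h3⟩ := mem_kasnerCircle_iff.1 hp
  constructor
  · have := rate_nonneg_of_tendsto_zero_atBot (fun t => (hx.2 t).2.1) hx.hasDerivAt_n2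
      ((continuous_rate2.tendsto p).comp h) (h2 ▸ h.snd_nhds.snd_nhds.fst_nhds)
    rw [rate2, hs] at this
    linarith
  · have := rate_nonneg_of_tendsto_zero_atBot (fun t => neg_pos.2 (hx.2 t).2.2)
      hx.hasDerivAt_neg_n3 ((continuous_rate3.tendsto p).comp h)
      (by simpa [show p.2.2.2 = 0 from h3] using h.snd_nhds.snd_nhds.snd_nhds.neg)
    rw [rate3, hs] at this
    linarith

/-- Rotating a point of the unit circle with `X + k Y = -2v` by a small angle in the right
direction increases `X + k Y`. -/
theorem exists_rotation (hv0 : 0 < v) (hv1 : v < 1) {X Y k : ℝ} (hk : k ^ 2 = 3)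
    (hXY : X ^ 2 + Y ^ 2 = 1) (h2 : X + k * Y = -2 * v) :
    ∃ σ : ℝ, σ ^ 2 = 1 ∧ ∀ θ : ℝ, 0 < θ → θ < 1 →
      -2 * v < (Real.cos θ * X - σ * Real.sin θ * Y) +
        k * (Real.cos θ * Y + σ * Real.sin θ * X) := by
  -- `k X - Y` is the angular derivative of `X + k Y`. It is nonzero because `v < 1`, and `σ` is
  -- chosen as its sign.
  have hD : (k * X - Y) ^ 2 = 4 - 4 * v ^ 2 := by
    have : (k * X - Y) ^ 2 + (X + k * Y) ^ 2 = 4 * (X ^ 2 + Y ^ 2) := by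
      linear_combination (X ^ 2 + Y ^ 2) * hk
    rw [h2, hXY] at this
    linarith
  have hD0 : k * X - Y ≠ 0 := by
    intro h
    rw [h] at hD
    nlinarith
  have hcase : ∃ σ : ℝ, σ ^ 2 = 1 ∧ 0 < σ * (k * X - Y) := by
    rcases lt_or_gt_of_ne hD0 with h | h
    · exact ⟨-1, by norm_num, by linarith⟩
    · exact ⟨1, by norm_num, by linarith⟩
  obtain ⟨σ, hσ, hpos⟩ := hcase
  refine ⟨σ, hσ, fun θ h0 h1 => ?_⟩
  have hs : 0 < Real.sin θ := Real.sin_pos_of_pos_of_lt_pi h0 (by linarith [Real.pi_gt_three])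
  have hc : Real.cos θ ≤ 1 := Real.cos_le_one θ
  have : (Real.cos θ * X - σ * Real.sin θ * Y) + k * (Real.cos θ * Y + σ * Real.sin θ * X) =
      Real.cos θ * (X + k * Y) + Real.sin θ * (σ * (k * X - Y)) := by ring
  rw [this, h2]
  nlinarith [mul_pos hs hpos]

theorem mem_stableSet_of_rotation {p : State} (hp : p ∈ kasnerCircle) {σ : ℝ} (hσ : σ ^ 2 = 1)
    (h : ∀ᶠ θ in 𝓝[>] (0 : ℝ),
      ((Real.cos θ * p.sigmaPlus - σ * Real.sin θ * p.sigmaMinus,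
        Real.cos θ * p.sigmaMinus + σ * Real.sin θ * p.sigmaPlus, 0, 0) : State) ∉
          arcA2 v ∪ arcA3 v) : p ∈ stableSet v := by
  refine ⟨hp, fun hint => ?_⟩
  obtain ⟨hs, h2, h3⟩ := mem_kasnerCircle_iff.1 hp
  set g : ℝ → State := fun θ => (Real.cos θ * p.sigmaPlus - σ * Real.sin θ * p.sigmaMinus,
    Real.cos θ * p.sigmaMinus + σ * Real.sin θ * p.sigmaPlus, 0, 0) with hg
  have hg0 : g 0 = p := by
    ext <;> simp [hg, show p.2.2.1 = 0 from h2, show p.2.2.2 = 0 from h3]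
  have hgc : Continuous g := by fun_prop
  have hlim : Tendsto g (𝓝[>] 0) (𝓝[kasnerCircle] p) := by
    apply tendsto_nhdsWithin_of_tendsto_nhds_of_eventually_within
    · rw [← hg0]
      exact (hgc.tendsto 0).mono_left nhdsWithin_le_nhds
    · refine Eventually.of_forall fun θ => ?_
      rw [mem_kasnerCircle_iff]
      refine ⟨?_, rfl, rfl⟩
      simp only [State.shearSq, hg] at hs ⊢
      have := Real.sin_sq_add_cos_sq θ
      calc _ = (Real.cos θ ^ 2 + σ ^ 2 * Real.sin θ ^ 2) *
            (p.sigmaPlus ^ 2 + p.sigmaMinus ^ 2) := by ring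
        _ = 1 := by rw [hs, hσ]; linarith
  obtain ⟨θ, h1, h2⟩ := ((hlim.eventually hint.2).and h).exists
  exact h2 h1

/-- At an endpoint of exactly one arc, a small rotation leaves that arc while the other strict
inequality survives. The case of two equalities must be excluded: for `v = 1/2` the arcs meet at
`T₁`, which is interior to their union. -/
theorem mem_stableSet (hv0 : 0 < v) (hv1 : v < 1) {p : State} (hp : p ∈ kasnerCircle)
    (h2 : -2 * v ≤ p.sigma2) (h3 : -2 * v ≤ p.sigma3)
    (h : p.sigma2 = -2 * v → p.sigma3 = -2 * v → False) : p ∈ stableSet v := by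
  obtain ⟨hs, hn2, hn3⟩ := mem_kasnerCircle_iff.1 hp
  have h01 : ∀ᶠ θ in 𝓝[>] (0 : ℝ), 0 < θ ∧ θ < 1 := Ioo_mem_nhdsGT one_pos
  have hk : √3 ^ 2 = 3 := Real.sq_sqrt (by norm_num)
  have hev : ∀ {g : ℝ → ℝ}, Continuous g → -2 * v < g 0 → ∀ᶠ θ in 𝓝[>] (0 : ℝ), -2 * v < g θ :=
    fun {g} hg h0 => (hg.tendsto 0).mono_left nhdsWithin_le_nhds |>.eventually (lt_mem_nhds h0)
  rcases h2.lt_or_eq with h2' | h2'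
  · rcases h3.lt_or_eq with h3' | h3'
    · refine ⟨hp, fun hint => ?_⟩
      rcases mem_of_mem_nhdsWithin hp hint.2 with h | h
      · exact absurd h.2 (not_le.2 h2')
      · exact absurd h.2 (not_le.2 h3')
    · obtain ⟨σ, hσ, hr⟩ := exists_rotation hv0 hv1 (X := p.sigmaPlus) (Y := p.sigmaMinus)
        (k := -√3) (by rw [neg_sq, hk]) hs (by rw [h3', State.sigma3]; ring)
      refine mem_stableSet_of_rotation hp hσ ?_
      filter_upwards [h01, hev (g := fun θ =>
        (Real.cos θ * p.sigmaPlus - σ * Real.sin θ * p.sigmaMinus) +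
        √3 * (Real.cos θ * p.sigmaMinus + σ * Real.sin θ * p.sigmaPlus)) (by fun_prop)
        (by simpa [State.sigma2] using h2')] with θ hθ hg
      rintro (hA | hA)
      · exact absurd hA.2 (not_le.2 hg)
      · have := hA.2
        simp only [State.sigma3] at this
        linarith [hr θ hθ.1 hθ.2]
  · rcases h3.lt_or_eq with h3' | h3'
    · obtain ⟨σ, hσ, hr⟩ := exists_rotation hv0 hv1 (X := p.sigmaPlus) (Y := p.sigmaMinus)
        (k := √3) hk hs (by rw [h2', State.sigma2])
      refine mem_stableSet_of_rotation hp hσ ?_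
      filter_upwards [h01, hev (g := fun θ =>
        (Real.cos θ * p.sigmaPlus - σ * Real.sin θ * p.sigmaMinus) -
        √3 * (Real.cos θ * p.sigmaMinus + σ * Real.sin θ * p.sigmaPlus)) (by fun_prop)
        (by simpa [State.sigma3] using h3')] with θ hθ hg
      rintro (hA | hA)
      · exact absurd hA.2 (not_le.2 (hr θ hθ.1 hθ.2))
      · exact absurd hA.2 (not_le.2 hg)
    · exact (h h2'.symm h3'.symm).elim

end Kasner

/-! ### The monotone offset `Σ₊ + 1/(2v)` -/

section Monotone

variable {v : ℝ} {x : ℝ → State} {M : Set State}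

theorem IsOrbitIn.hasDerivAt_offset (hx : IsOrbitIn v M x) (hv : v ≠ 0) (t : ℝ) :
    HasDerivAt (fun t => (x t).sigmaPlus + 1 / (2 * v))
      (4 * v * (1 - (x t).shearSq) * ((x t).sigmaPlus + 1 / (2 * v))) t :=
  ((hx.1 t).sigmaPlus.add_const _).congr_deriv (by simp [vectorField]; field_simp; ring)

/-- The sign of `Σ₊ + 1 / (2v)` is preserved. -/
theorem IsOrbitIn.offset_eq (hx : IsOrbitIn v M x) (hv : v ≠ 0) (t : ℝ) :
    ∃ c > 0, (x t).sigmaPlus + 1 / (2 * v) = ((x 0).sigmaPlus + 1 / (2 * v)) * c := by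
  have hxc := hx.continuous
  exact ⟨_, Real.exp_pos _, eq_mul_exp_of_hasDerivAt_mul
    (r := fun t => 4 * v * (1 - (x t).shearSq)) (by fun_prop) (hx.hasDerivAt_offset hv) t⟩

theorem one_sub_shearSq_nonneg {p : State} (hp : p ∈ closedVI0) : 0 ≤ 1 - p.shearSq := by
  rw [hp.1.one_sub_shearSq]; positivity

theorem abs_sigmaPlus_le_one {p : State} (hp : p ∈ closedVI0) :
    -1 ≤ p.sigmaPlus ∧ p.sigmaPlus ≤ 1 := by
  have := one_sub_shearSq_nonneg hp
  simp only [State.shearSq] at this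
  constructor <;> nlinarith [sq_nonneg p.sigmaMinus]

theorem IsOrbitIn.monotone_sigmaPlus (hx : IsOrbitIn v closedVI0 x) (hv : 0 < v)
    (h : 0 ≤ (x 0).sigmaPlus + 1 / (2 * v)) : Monotone fun t => (x t).sigmaPlus + 1 / (2 * v) := by
  refine monotone_of_hasDerivAt_nonneg (hx.hasDerivAt_offset hv.ne') fun t => ?_
  obtain ⟨c, hc, he⟩ := hx.offset_eq hv.ne' t
  rw [Pi.zero_apply, he]
  have := one_sub_shearSq_nonneg (hx.2 t)
  positivity

theorem IsOrbitIn.antitone_sigmaPlus (hx : IsOrbitIn v closedVI0 x) (hv : 0 < v)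
    (h : (x 0).sigmaPlus + 1 / (2 * v) ≤ 0) : Antitone fun t => (x t).sigmaPlus + 1 / (2 * v) := by
  refine antitone_of_hasDerivAt_nonpos (hx.hasDerivAt_offset hv.ne') fun t => ?_
  obtain ⟨c, hc, he⟩ := hx.offset_eq hv.ne' t
  rw [Pi.zero_apply, he]
  have := one_sub_shearSq_nonneg (hx.2 t)
  exact mul_nonpos_of_nonneg_of_nonpos (by positivity)
    (mul_nonpos_of_nonpos_of_nonneg h hc.le)

theorem IsOrbitIn.exists_tendsto_stable (hx : IsOrbitIn v typeVI0 x) (hv0 : 0 < v) (hv1 : v < 1)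
    (h : (x 0).sigmaPlus + 1 / (2 * v) ≠ 0) : ∃ p ∈ stableSet v, Tendsto x atTop (𝓝 p) := by
  have hxc := hx.mono typeVI0_subset
  have hlim : ∃ l, Tendsto (fun t => (x t).sigmaPlus + 1 / (2 * v)) atTop (𝓝 l) ∧ l ≠ 0 := by
    rcases lt_or_gt_of_ne h with h | h
    · obtain ⟨l, hl, hle⟩ := (hxc.antitone_sigmaPlus hv0 h.le).exists_tendsto_atTop
        (C := -1 + 1 / (2 * v)) fun t => by linarith [(abs_sigmaPlus_le_one (hxc.2 t)).1]
      exact ⟨l, hl, by linarith [hle 0]⟩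
    · obtain ⟨l, hl, hle⟩ := (hxc.monotone_sigmaPlus hv0 h.le).exists_tendsto_atTop
        (C := 1 + 1 / (2 * v)) fun t => by linarith [(abs_sigmaPlus_le_one (hxc.2 t)).2]
      exact ⟨l, hl, by linarith [hle 0]⟩
  obtain ⟨l, hl, hl0⟩ := hlim
  have hd := tendsto_deriv_zero_atTop (hx.hasDerivAt_offset hv0.ne')
    (hxc.uniformContinuous_comp (φ := fun p =>
      4 * v * (1 - p.shearSq) * (p.sigmaPlus + 1 / (2 * v))) (by fun_prop)) hl
  have hu : Tendsto (fun t => 1 - (x t).shearSq) atTop (𝓝 0) := by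
    have := (hd.div hl hl0).div_const (4 * v)
    rw [zero_div, zero_div] at this
    refine this.congr' ?_
    filter_upwards [hl.eventually_ne hl0] with t ht
    rw [Pi.div_apply, mul_div_cancel_right₀ _ ht, mul_div_cancel_left₀ _ (by positivity)]
  obtain ⟨p, hp, hpl, hlim⟩ := hxc.tendsto_kasner_atTop (ξ := l - 1 / (2 * v))
    (by simpa using hl.sub_const (1 / (2 * v))) hu
  obtain ⟨h2, h3⟩ := hx.sigma_ge_of_tendsto_atTop hp hlim
  -- Two equalities would give `Σ₊ = -2v` and `Σ₋ = 0`, hence `v = 1/2` and offset limit `-1 + 1 =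
  -- 0`, contrary to `l ≠ 0`.
  refine ⟨p, mem_stableSet hv0 hv1 hp h2 h3 fun e2 e3 => hl0 ?_, hlim⟩
  have hs := (mem_kasnerCircle_iff.1 hp).1
  have hk : √3 ≠ 0 := by positivity
  rw [State.sigma2] at e2
  rw [State.sigma3] at e3
  have hX : p.sigmaPlus = -2 * v := by linarith
  have hY : p.sigmaMinus = 0 := by
    have : √3 * p.sigmaMinus = 0 := by linarith
    exact (mul_eq_zero.1 this).resolve_left hk
  rw [State.shearSq, hX, hY] at hs
  have hvh : v = 1 / 2 := by nlinarith
  rw [hX, hvh] at hpl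
  linarith

theorem IsOrbitIn.exists_tendsto_arcs (hx : IsOrbitIn v typeVI0 x) (hv0 : 0 < v)
    (hv : v ≤ 1 / 2) : ∃ p ∈ arcA2 v ∩ arcA3 v, Tendsto x atBot (𝓝 p) := by
  have hxc := hx.mono typeVI0_subset
  have hv1 : 1 ≤ 1 / (2 * v) := by rw [le_div_iff₀ (by positivity)]; linarith
  obtain ⟨l, hl, hle⟩ := (hxc.monotone_sigmaPlus hv0
    (by linarith [(abs_sigmaPlus_le_one (hxc.2 0)).1])).exists_tendsto_atBot
    (C := 0) fun t => by linarith [(abs_sigmaPlus_le_one (hxc.2 t)).1]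
  have hl0 : 0 ≤ l := ge_of_tendsto' hl fun t => by linarith [(abs_sigmaPlus_le_one (hxc.2 t)).1]
  have hX : Tendsto (fun t => (x t).sigmaPlus) atBot (𝓝 (l - 1 / (2 * v))) := by
    simpa using hl.sub_const (1 / (2 * v))
  have hu : Tendsto (fun t => 1 - (x t).shearSq) atBot (𝓝 0) := by
    rcases hl0.lt_or_eq with hl0 | hl0
    · have hd := tendsto_deriv_zero_atBot (hx.hasDerivAt_offset hv0.ne')
        (hxc.uniformContinuous_comp (φ := fun p =>
          4 * v * (1 - p.shearSq) * (p.sigmaPlus + 1 / (2 * v))) (by fun_prop)) hl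
      have := (hd.div hl hl0.ne').div_const (4 * v)
      rw [zero_div, zero_div] at this
      refine this.congr' ?_
      filter_upwards [hl.eventually_ne hl0.ne'] with t ht
      rw [Pi.div_apply, mul_div_cancel_right₀ _ ht, mul_div_cancel_left₀ _ (by positivity)]
    -- Barbalat's lemma says nothing about `1 - Σ²` when `l = 0`. But then `Σ₊ → -1`, and `1 - Σ² ≤
    -- 1 - Σ₊²` suffices.
    · have hb : -1 ≤ l - 1 / (2 * v) :=
        ge_of_tendsto' hX fun t => (abs_sigmaPlus_le_one (hxc.2 t)).1
      have he : l - 1 / (2 * v) = -1 := by linarith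
      rw [he] at hX
      have hsq := (hX.pow 2).const_sub 1
      refine squeeze_zero (fun t => one_sub_shearSq_nonneg (hxc.2 t))
        (fun t => show _ ≤ 1 - (x t).sigmaPlus ^ 2 from ?_) (by simpa using hsq)
      simp only [State.shearSq]
      linarith [sq_nonneg (x t).sigmaMinus]
  obtain ⟨p, hp, -, hlim⟩ := hxc.tendsto_kasner_atBot hX hu
  obtain ⟨h2, h3⟩ := hx.sigma_le_of_tendsto_atBot hp hlim
  exact ⟨p, ⟨⟨hp, h2⟩, hp, h3⟩, hlim⟩

theorem arcA2_inter_arcA3_half : arcA2 (1 / 2) ∩ arcA3 (1 / 2) = {taubT1} := by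
  ext p
  rw [Set.mem_singleton_iff]
  constructor
  · rintro ⟨⟨hp, h2⟩, -, h3⟩
    obtain ⟨hs, hn2, hn3⟩ := mem_kasnerCircle_iff.1 hp
    rw [State.sigma2] at h2
    rw [State.sigma3] at h3
    rw [State.shearSq] at hs
    have hX : p.sigmaPlus = -1 := by nlinarith [sq_nonneg p.sigmaMinus]
    have hY : p.sigmaMinus = 0 := by
      rw [hX] at hs
      exact pow_eq_zero_iff two_ne_zero |>.1 (by linarith)
    ext
    exacts [hX, hY, hn2, hn3]
  · rintro rfl
    have : taubT1 ∈ kasnerCircle := mem_kasnerCircle_of_sq (by norm_num)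
    refine ⟨⟨this, ?_⟩, this, ?_⟩ <;>
      simp [State.sigma2, State.sigma3, State.sigmaPlus, State.sigmaMinus, taubT1]

end Monotone

/-! ### The fixed point as the past attractor for `v > 1/2` -/

theorem Antitone.exists_tendsto_atBot {f : ℝ → ℝ} {C : ℝ} (hf : Antitone f) (hC : ∀ t, f t ≤ C) :
    ∃ l, Tendsto f atBot (𝓝 l) ∧ ∀ t, f t ≤ l := by
  have hb : BddAbove (Set.range f) := ⟨C, by rintro _ ⟨t, rfl⟩; exact hC t⟩
  exact ⟨_, tendsto_atBot_ciSup hf hb, fun t => le_ciSup hb t⟩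

section FixedPoint

variable {v : ℝ} {x : ℝ → State} {M : Set State}

theorem one_sub_inv_sq_pos (hv : 1 / 2 < v) : 0 < 1 - 1 / (4 * v ^ 2) := by
  have : 0 < v := by linarith
  rw [sub_pos, div_lt_one (by positivity)]
  nlinarith

theorem fixedPointVI0_mem (hv : 1 / 2 < v) : fixedPointVI0 v ∈ typeVI0 := by
  have hr := one_sub_inv_sq_pos hv
  have hv0 : v ≠ 0 := by linarith
  refine ⟨?_, ?_, ?_⟩
  · simp only [State.Constraint, State.shearSq, fixedPointVI0]
    have h1 : (√(1 - 1 / (4 * v ^ 2)) / 2 - -(√(1 - 1 / (4 * v ^ 2)) / 2)) ^ 2 =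
        √(1 - 1 / (4 * v ^ 2)) ^ 2 := by ring
    rw [h1, Real.sq_sqrt hr.le]
    field_simp
    ring
  · have := Real.sqrt_pos.2 hr
    simp only [fixedPointVI0]
    positivity
  · have := Real.sqrt_pos.2 hr
    simp only [fixedPointVI0, State.n3]
    linarith

theorem isOrbitIn_fixedPointVI0 (hv : 1 / 2 < v) :
    IsOrbitIn v typeVI0 fun _ => fixedPointVI0 v := by
  refine ⟨fun t => ?_, fun _ => fixedPointVI0_mem hv⟩
  have hv0 : v ≠ 0 := by linarith
  have h : vectorField v (fixedPointVI0 v) = 0 := by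
    ext
    · simp only [vectorField, fixedPointVI0, State.shearSq, Prod.fst_zero]
      field_simp
      ring
    · simp [vectorField, fixedPointVI0, State.sigmaMinus, State.n2, State.n3]
    · simp only [vectorField, fixedPointVI0, State.shearSq, Prod.fst_zero, Prod.snd_zero]
      field_simp
      ring
    · simp only [vectorField, fixedPointVI0, State.shearSq, Prod.snd_zero]
      field_simp
      ring
  simpa only [h] using hasDerivAt_const t (fixedPointVI0 v)

/-- The limits of `Σ₊` and `Σ₋` make `N₂ - N₃` converge to a positive number; then `Σ₋' → 0` forces
`(N₂ - N₃)(N₂ + N₃) → 0`, so `N₂ + N₃ → 0`. -/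
theorem tendsto_fixedPointVI0 (hv : 1 / 2 < v) {l : Filter ℝ} (hx : ∀ t, x t ∈ closedVI0)
    (hX : Tendsto (fun t => (x t).sigmaPlus + 1 / (2 * v)) l (𝓝 0))
    (hY : Tendsto (fun t => (x t).sigmaMinus) l (𝓝 0))
    (hY' : Tendsto (fun t => (vectorField v (x t)).sigmaMinus) l (𝓝 0)) :
    Tendsto x l (𝓝 (fixedPointVI0 v)) := by
  have hr := one_sub_inv_sq_pos hv
  have hv0 : v ≠ 0 := by linarith
  have hXl : Tendsto (fun t => (x t).sigmaPlus) l (𝓝 (-1 / (2 * v))) := by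
    have := hX.sub_const (1 / (2 * v))
    simp only [add_sub_cancel_right] at this
    convert this using 2
    ring
  have hu : Tendsto (fun t => 1 - (x t).shearSq) l (𝓝 (1 - 1 / (4 * v ^ 2))) := by
    have := ((hXl.pow 2).add (hY.pow 2)).const_sub 1
    convert this using 2
    · simp only [State.shearSq]
    · field_simp
      ring
  set R := √(1 - 1 / (4 * v ^ 2)) with hR
  have hR0 : 0 < R := Real.sqrt_pos.2 hr
  have hd : Tendsto (fun t => (x t).n2 - (x t).n3) l (𝓝 R) := by
    refine ((Real.continuous_sqrt.tendsto _).comp hu).congr fun t => ?_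
    rw [Function.comp_apply, (hx t).1.one_sub_shearSq, Real.sqrt_sq]
    linarith [(hx t).2.1, (hx t).2.2]
  have hs : Tendsto (fun t => (x t).n2 + (x t).n3) l (𝓝 0) := by
    have h1 := (hY'.sub ((hu.const_mul (4 * v)).mul hY)).div (hd.const_mul (2 * √3))
      (by positivity)
    rw [mul_zero, sub_zero, zero_div] at h1
    refine h1.congr' ?_
    filter_upwards [hd.eventually_ne hR0.ne'] with t ht
    have hk : √3 ≠ 0 := by positivity
    simp only [Pi.div_apply, vectorField]
    rw [div_eq_iff (by positivity)]
    ring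
  refine State.tendsto_of_components hXl hY ?_ ?_
  · have := (hs.add hd).div_const 2
    convert this using 2
    · ring
    · simp [fixedPointVI0, hR]
  · have := (hs.sub hd).div_const 2
    convert this using 2
    · ring
    · simp [fixedPointVI0, hR, neg_div]

/-- The `√3 Σ₋` terms cancel in the sum of the two growth rates. What remains is `-8vΣ₋²` plus a
term proportional to the offset, so on the plane where the offset vanishes the product is monotone.
-/
theorem IsOrbitIn.hasDerivAt_prod (hx : IsOrbitIn v M x) (hv : v ≠ 0) (t : ℝ) :
    HasDerivAt (fun t => -((x t).n2 * (x t).n3))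
      ((-8 * v * (x t).sigmaMinus ^ 2 -
        8 * v * (x t).sigmaPlus * ((x t).sigmaPlus + 1 / (2 * v))) * -((x t).n2 * (x t).n3)) t := by
  refine ((hx.hasDerivAt_n2 t).mul (hx.hasDerivAt_n3 t)).neg.congr_deriv ?_
  simp only [rate2, rate3, State.sigma2, State.sigma3, State.shearSq]
  field_simp
  ring

theorem prod_pos {p : State} (hp : p ∈ typeVI0) : 0 < -(p.n2 * p.n3) := by
  have := mul_pos hp.2.1 (neg_pos.2 hp.2.2)
  linarith

theorem prod_le_one {p : State} (hp : p ∈ closedVI0) : -(p.n2 * p.n3) ≤ 1 := by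
  have h := hp.1.one_sub_shearSq
  simp only [State.shearSq] at h
  nlinarith [sq_nonneg p.sigmaPlus, sq_nonneg p.sigmaMinus, sq_nonneg (p.n2 + p.n3),
    sq_nonneg (p.n2 - p.n3)]

theorem IsOrbitIn.exists_abs_offset_le (hx : IsOrbitIn v typeVI0 x) (hv : 1 / 2 < v) :
    ∃ C, 0 ≤ C ∧ ∀ t ≤ 0, |(x t).sigmaPlus + 1 / (2 * v)| ≤
      C * Real.exp (4 * v * (1 - 1 / (4 * v ^ 2)) * t) := by
  have hv0 : 0 < v := by linarith
  -- This is the growth rate `4v(1 - Σ²)` of the offset at the fixed point; with it, the coefficient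
  -- in `g'` completes to a sum of squares.
  set c := 4 * v * (1 - 1 / (4 * v ^ 2)) with hc
  set g : ℝ → ℝ := fun t => ((x t).sigmaPlus + 1 / (2 * v)) / -((x t).n2 * (x t).n3) *
    Real.exp (-(c * t)) with hg
  have hg' : ∀ t, HasDerivAt g (4 * v * (((x t).sigmaPlus + 1 / (2 * v)) ^ 2 +
      (x t).sigmaMinus ^ 2) * g t) t := fun t => by
    have hP := (prod_pos (hx.2 t)).ne'
    have h2 : HasDerivAt (fun t => Real.exp (-(c * t))) (Real.exp (-(c * t)) * (-c)) t := by
      simpa using (((hasDerivAt_id t).const_mul c).neg).exp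
    refine (((hx.hasDerivAt_offset hv0.ne' t).div (hx.hasDerivAt_prod hv0.ne' t) hP).mul
      h2).congr_deriv ?_
    simp only [hg, hc, State.shearSq, Pi.div_apply]
    generalize -((x t).n2 * (x t).n3) = P at hP
    field_simp
    ring
  have hm : Monotone fun t => g t ^ 2 := by
    refine monotone_of_hasDerivAt_nonneg (fun t => (hg' t).pow 2) fun t => ?_
    have : (2 : ℕ) * g t ^ (2 - 1) * (4 * v * (((x t).sigmaPlus + 1 / (2 * v)) ^ 2 +
      (x t).sigmaMinus ^ 2) * g t) = 8 * v * (((x t).sigmaPlus + 1 / (2 * v)) ^ 2 +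
      (x t).sigmaMinus ^ 2) * g t ^ 2 := by push_cast; ring
    rw [Pi.zero_apply, this]
    positivity
  refine ⟨|g 0|, abs_nonneg _, fun t ht => ?_⟩
  have h1 : |g t| ≤ |g 0| := sq_le_sq.1 (hm ht)
  have hP := prod_pos (hx.2 t)
  have h2 : (x t).sigmaPlus + 1 / (2 * v) = g t * Real.exp (c * t) * -((x t).n2 * (x t).n3) := by
    simp only [hg]
    rw [mul_assoc (_ / _), ← Real.exp_add, neg_add_cancel, Real.exp_zero, mul_one,
      div_mul_cancel₀ _ hP.ne']
  rw [h2, abs_mul, abs_mul, abs_of_pos hP, Real.abs_exp]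
  calc |g t| * Real.exp (c * t) * -((x t).n2 * (x t).n3)
      ≤ |g t| * Real.exp (c * t) * 1 := by
        gcongr
        exact prod_le_one (typeVI0_subset (hx.2 t))
    _ ≤ |g 0| * Real.exp (c * t) := by rw [mul_one]; gcongr

theorem IsOrbitIn.tendsto_fixedPointVI0_atBot (hx : IsOrbitIn v typeVI0 x) (hv : 1 / 2 < v) :
    Tendsto x atBot (𝓝 (fixedPointVI0 v)) := by
  have hv0 : 0 < v := by linarith
  have hxc := hx.mono typeVI0_subset
  obtain ⟨C, hC, hw⟩ := hx.exists_abs_offset_le hv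
  set c := 4 * v * (1 - 1 / (4 * v ^ 2)) with hc
  have hc0 : 0 < c := mul_pos (by positivity) (one_sub_inv_sq_pos hv)
  have hexp : Tendsto (fun t => Real.exp (c * t)) atBot (𝓝 0) :=
    Real.tendsto_exp_atBot.comp (tendsto_id.const_mul_atBot hc0)
  have hX : Tendsto (fun t => (x t).sigmaPlus + 1 / (2 * v)) atBot (𝓝 0) := by
    refine squeeze_zero_norm' ?_ (by simpa using hexp.const_mul C)
    filter_upwards [eventually_le_atBot 0] with t ht using hw t ht
  set r : State → ℝ := fun p => -8 * v * p.sigmaMinus ^ 2 -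
    8 * v * p.sigmaPlus * (p.sigmaPlus + 1 / (2 * v)) with hr
  set P : ℝ → ℝ := fun t => Real.log (-((x t).n2 * (x t).n3)) with hP
  have hP' : ∀ t, HasDerivAt P (r (x t)) t := fun t => by
    have h := prod_pos (hx.2 t)
    refine ((hx.hasDerivAt_prod hv0.ne' t).log h.ne').congr_deriv ?_
    rw [mul_div_cancel_right₀ _ h.ne']
  -- The subtracted term has derivative `8vC e^{ct}`, which dominates the indefinite part `-8vΣ₊w`
  -- of `P'` for `t ≤ 0`.
  set L : ℝ → ℝ := fun t => P t - 8 * v * C / c * Real.exp (c * t) with hL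
  have hL' : ∀ t, HasDerivAt L (r (x t) - 8 * v * C * Real.exp (c * t)) t := fun t => by
    have h2 : HasDerivAt (fun t => Real.exp (c * t)) (Real.exp (c * t) * c) t := by
      simpa using ((hasDerivAt_id t).const_mul c).exp
    refine ((hP' t).sub (h2.const_mul (8 * v * C / c))).congr_deriv ?_
    field_simp
  have hanti : AntitoneOn L (Set.Iic 0) := by
    apply antitoneOn_of_deriv_nonpos (convex_Iic 0)
      (fun t _ => (hL' t).continuousAt.continuousWithinAt)
      (fun t _ => (hL' t).differentiableAt.differentiableWithinAt)
    intro t ht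
    rw [interior_Iic] at ht
    rw [(hL' t).deriv]
    have h1 := abs_sigmaPlus_le_one (hxc.2 t)
    have h2 : |(x t).sigmaPlus * ((x t).sigmaPlus + 1 / (2 * v))| ≤ C * Real.exp (c * t) := by
      rw [abs_mul]
      calc _ ≤ 1 * |(x t).sigmaPlus + 1 / (2 * v)| := by gcongr; exact abs_le.2 h1
        _ ≤ _ := by rw [one_mul]; exact hw t ht.le
    have h3 := (abs_le.1 h2).1
    simp only [hr]
    nlinarith [sq_nonneg (x t).sigmaMinus]
  have hanti' : Antitone fun t => L (min t 0) := fun s t hst =>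
    hanti (Set.mem_Iic.2 (min_le_right _ _)) (Set.mem_Iic.2 (min_le_right _ _))
      (min_le_min_right 0 hst)
  obtain ⟨l, hl, -⟩ := hanti'.exists_tendsto_atBot (C := 0) fun t => by
    have h1 : P (min t 0) ≤ 0 :=
      Real.log_nonpos (prod_pos (hx.2 _)).le (prod_le_one (hxc.2 _))
    have : 0 ≤ 8 * v * C / c * Real.exp (c * min t 0) := by positivity
    simp only [hL]
    linarith
  have hPl : Tendsto P atBot (𝓝 l) := by
    have := hl.add (hexp.const_mul (8 * v * C / c))
    rw [mul_zero, add_zero] at this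
    refine this.congr' ?_
    filter_upwards [eventually_le_atBot 0] with t ht
    simp [hL, min_eq_left ht]
  have hr0 := tendsto_deriv_zero_atBot hP' (hxc.uniformContinuous_comp (φ := r) (by fun_prop)) hPl
  have hXl : Tendsto (fun t => (x t).sigmaPlus) atBot (𝓝 (0 - 1 / (2 * v))) := by
    simpa using hX.sub_const (1 / (2 * v))
  have hYsq : Tendsto (fun t => (x t).sigmaMinus ^ 2) atBot (𝓝 (0 ^ 2)) := by
    have := (hr0.add ((hXl.mul hX).const_mul (8 * v))).div_const (-8 * v)
    simp only [mul_zero, add_zero, zero_div] at this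
    rw [zero_pow two_ne_zero]
    refine this.congr fun t => ?_
    simp only [hr]
    field_simp
    ring
  obtain ⟨d, hd, hY⟩ := Continuous.exists_tendsto_of_sq_atBot
    (by have := hx.continuous; fun_prop) hYsq
  have hd0 : d = 0 := by simpa using hd
  rw [hd0] at hY
  exact tendsto_fixedPointVI0 hv hxc.2 hX hY (tendsto_deriv_zero_atBot
    (fun t => (hx.1 t).sigmaMinus) (hxc.uniformContinuous_comp
      (φ := fun p => (vectorField v p).sigmaMinus) (by unfold vectorField; fun_prop)) hY)

end FixedPoint

/-! ### Monotonicity on half-lines and the reflection symmetry -/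

theorem AntitoneOn.exists_tendsto_atTop {f : ℝ → ℝ} {C T : ℝ} (hf : AntitoneOn f (Set.Ici T))
    (hC : ∀ t, T ≤ t → C ≤ f t) : ∃ l, Tendsto f atTop (𝓝 l) ∧ ∀ t, T ≤ t → l ≤ f t := by
  have h : Antitone fun t => f (max t T) := fun s t hst =>
    hf (Set.mem_Ici.2 (le_max_right _ _)) (Set.mem_Ici.2 (le_max_right _ _))
      (max_le_max_right T hst)
  obtain ⟨l, hl, hle⟩ := h.exists_tendsto_atTop fun t => hC _ (le_max_right t T)
  refine ⟨l, hl.congr' ?_, fun t ht => by simpa [max_eq_left ht] using hle t⟩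
  filter_upwards [eventually_ge_atTop T] with t ht
  rw [max_eq_left ht]

theorem antitoneOn_Ici_of_hasDerivAt_nonpos {f f' : ℝ → ℝ} {T : ℝ}
    (hf : ∀ t, HasDerivAt f (f' t) t) (h : ∀ t, T ≤ t → f' t ≤ 0) : AntitoneOn f (Set.Ici T) := by
  apply antitoneOn_of_deriv_nonpos (convex_Ici T)
    (fun t _ => (hf t).continuousAt.continuousWithinAt)
    (fun t _ => (hf t).differentiableAt.differentiableWithinAt)
  intro t ht
  rw [interior_Ici] at ht
  rw [(hf t).deriv]
  exact h t ht.le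

/-- The reflection symmetry that interchanges the types II₂ and II₃. -/
def reflect (p : State) : State := (p.sigmaPlus, -p.sigmaMinus, -p.n3, -p.n2)

section Reflect

variable {v : ℝ} {x : ℝ → State}

theorem reflect_reflect (p : State) : reflect (reflect p) = p := by
  simp [reflect, State.sigmaPlus, State.sigmaMinus, State.n2, State.n3]

@[fun_prop]
theorem continuous_reflect : Continuous reflect := by unfold reflect; fun_prop

theorem reflect_constraint {p : State} (hp : p.Constraint) : (reflect p).Constraint := by
  unfold State.Constraint State.shearSq reflect at *
  simp only [State.sigmaPlus, State.sigmaMinus, State.n2, State.n3] at *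
  linarith

theorem reflect_mem_typeVI0 {p : State} (hp : p ∈ typeVI0) : reflect p ∈ typeVI0 :=
  ⟨reflect_constraint hp.1, neg_pos.2 hp.2.2, neg_neg_iff_pos.2 hp.2.1⟩

theorem reflect_mem_typeII3 {p : State} (hp : p ∈ typeII2) : reflect p ∈ typeII3 :=
  ⟨reflect_constraint hp.1, neg_eq_zero.2 hp.2.2, neg_neg_iff_pos.2 hp.2.1⟩

theorem reflect_mem_typeII2 {p : State} (hp : p ∈ typeII3) : reflect p ∈ typeII2 :=
  ⟨reflect_constraint hp.1, neg_pos.2 hp.2.2, neg_eq_zero.2 hp.2.1⟩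

theorem IsOrbitIn.reflect {M N : Set State} (hx : IsOrbitIn v M x)
    (hMN : ∀ p ∈ M, reflect p ∈ N) : IsOrbitIn v N fun t => _root_.reflect (x t) := by
  refine ⟨fun t => ?_, fun t => hMN _ (hx.2 t)⟩
  have h := hx.1 t
  refine (h.sigmaPlus.prodMk (h.sigmaMinus.neg.prodMk (h.n3.neg.prodMk h.n2.neg))).congr_deriv ?_
  simp only [vectorField, _root_.reflect, State.shearSq]
  ext <;> simp <;> ring

end Reflect

/-! ### The heteroclinic cycle in the invariant plane -/

/-- The radius of the circle `Σ₋² + (N₂ - N₃)² = R²` in the plane `Σ₊ = -1 / (2v)`. -/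
noncomputable def radius (v : ℝ) : ℝ := √(1 - 1 / (4 * v ^ 2))

/-- The Kasner points in the plane `Σ₊ = -1 / (2v)`, for `d = ± radius v`. -/
noncomputable def kasnerPoint (v d : ℝ) : State := (-1 / (2 * v), d, 0, 0)

/-- The midpoint of the type II₂ orbit in the plane `Σ₊ = -1 / (2v)`. -/
noncomputable def midpointII2 (v : ℝ) : State := (-1 / (2 * v), 0, radius v, 0)

section Cycle

variable {v : ℝ} {x y : ℝ → State}

theorem radius_sq (hv : 1 / 2 < v) : radius v ^ 2 = 1 - 1 / (4 * v ^ 2) :=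
  Real.sq_sqrt (one_sub_inv_sq_pos hv).le

theorem radius_pos (hv : 1 / 2 < v) : 0 < radius v := Real.sqrt_pos.2 (one_sub_inv_sq_pos hv)

/-- Here `(2vR)² = 4v² - 1 < 3` because `v < 1`. This keeps `4vΣ₋ + 2√3` positive for `|Σ₋| ≤ R`, so
`Σ₋` has no equilibrium on the type II₂ arc. -/
theorem two_mul_radius_lt (hv : 1 / 2 < v) (hv1 : v < 1) : 2 * v * radius v < √3 := by
  apply Real.lt_sqrt_of_sq_lt
  have hv0 : v ≠ 0 := by linarith
  have : (2 * v * radius v) ^ 2 = 4 * v ^ 2 - 1 := by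
    rw [mul_pow, radius_sq hv]
    field_simp
    ring
  rw [this]
  nlinarith

theorem mem_separatrix_iff {p : State} : p ∈ separatrix v ↔ p.sigmaPlus + 1 / (2 * v) = 0 := by
  rw [separatrix, Set.mem_ofPred_eq, eq_neg_iff_add_eq_zero.symm, neg_div]

theorem one_sub_shearSq_of_mem_separatrix (hv : 1 / 2 < v) {p : State} (hp : p ∈ separatrix v) :
    1 - p.shearSq = radius v ^ 2 - p.sigmaMinus ^ 2 := by
  have hv0 : v ≠ 0 := by linarith
  have hX : p.sigmaPlus = -1 / (2 * v) := hp
  rw [radius_sq hv, State.shearSq, hX]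
  field_simp
  ring

theorem sq_eq_of_mem_separatrix (hv : 1 / 2 < v) {p : State} (hC : p.Constraint)
    (hp : p ∈ separatrix v) : (p.n2 - p.n3) ^ 2 = radius v ^ 2 - p.sigmaMinus ^ 2 := by
  rw [← hC.one_sub_shearSq, one_sub_shearSq_of_mem_separatrix hv hp]

theorem abs_sigmaMinus_le (hv : 1 / 2 < v) {p : State} (hC : p.Constraint)
    (hp : p ∈ separatrix v) : -radius v ≤ p.sigmaMinus ∧ p.sigmaMinus ≤ radius v := by
  have h := sq_eq_of_mem_separatrix hv hC hp
  exact abs_le.1 (abs_le_of_sq_le_sq (by nlinarith [sq_nonneg (p.n2 - p.n3)]) (radius_pos hv).le)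

theorem abs_sigmaMinus_lt (hv : 1 / 2 < v) {p : State} (hC : p.Constraint)
    (hp : p ∈ separatrix v) (h0 : 0 < p.n2 - p.n3) :
    -radius v < p.sigmaMinus ∧ p.sigmaMinus < radius v := by
  have h := sq_eq_of_mem_separatrix hv hC hp
  exact abs_lt.1 (abs_lt_of_sq_lt_sq (by nlinarith) (radius_pos hv).le)

theorem IsOrbitIn.mem_separatrix {M : Set State} (hx : IsOrbitIn v M x) (hv : v ≠ 0)
    (h : x 0 ∈ separatrix v) (t : ℝ) : x t ∈ separatrix v := by
  rw [mem_separatrix_iff] at h ⊢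
  obtain ⟨c, -, hc⟩ := hx.offset_eq hv t
  rw [hc, h, zero_mul]

theorem kasnerPoint_mem (hv : 1 / 2 < v) {d : ℝ} (hd : d ^ 2 = radius v ^ 2) :
    kasnerPoint v d ∈ kasnerCircle := by
  have hv0 : v ≠ 0 := by linarith
  apply mem_kasnerCircle_of_sq
  rw [hd, radius_sq hv]
  field_simp
  ring

theorem midpointII2_mem (hv : 1 / 2 < v) : midpointII2 v ∈ typeII2 := by
  have hv0 : v ≠ 0 := by linarith
  refine ⟨?_, radius_pos hv, rfl⟩
  simp only [State.Constraint, State.shearSq, midpointII2, State.sigmaPlus, State.sigmaMinus,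
    State.n2, State.n3, sub_zero]
  rw [radius_sq hv]
  field_simp
  ring

theorem kasner_inter_separatrix (hv : 1 / 2 < v) :
    kasnerCircle ∩ separatrix v = {kasnerPoint v (-radius v), kasnerPoint v (radius v)} := by
  ext p
  simp only [Set.mem_inter_iff, Set.mem_insert_iff, Set.mem_singleton_iff]
  constructor
  · rintro ⟨⟨hC, h2, h3⟩, hp⟩
    have h := sq_eq_of_mem_separatrix hv hC hp
    rw [h2, h3, sub_zero, zero_pow two_ne_zero] at h
    rcases sq_eq_sq_iff_eq_or_eq_neg.1 (show p.sigmaMinus ^ 2 = radius v ^ 2 by linarith) with h | h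
    · right; ext; exacts [hp, h, h2, h3]
    · left; ext; exacts [hp, h, h2, h3]
  · rintro (rfl | rfl)
    · exact ⟨kasnerPoint_mem hv (by ring), rfl⟩
    · exact ⟨kasnerPoint_mem hv rfl, rfl⟩

/-- An orbit in the plane `Σ₊ = -1 / (2v)` converges to a Kasner point if `Σ₋` tends to
`± radius v`. -/
theorem tendsto_kasnerPoint (hv : 1 / 2 < v) {l : Filter ℝ} (hx : ∀ t, x t ∈ closedVI0)
    (hs : ∀ t, x t ∈ separatrix v) {d : ℝ} (hd : d ^ 2 = radius v ^ 2)
    (hY : Tendsto (fun t => (x t).sigmaMinus) l (𝓝 d)) : Tendsto x l (𝓝 (kasnerPoint v d)) := by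
  have hu : Tendsto (fun t => 1 - (x t).shearSq) l (𝓝 0) := by
    have := (hY.pow 2).const_sub (radius v ^ 2)
    rw [hd, sub_self] at this
    exact this.congr fun t => (one_sub_shearSq_of_mem_separatrix hv (hs t)).symm
  obtain ⟨h2, h3⟩ := tendsto_n2_n3_zero hx hu
  exact State.tendsto_of_components (tendsto_const_nhds.congr fun t => (hs t).symm) hY h2 h3

theorem IsOrbitIn.hasDerivAt_sigmaMinus_typeII2 (hy : IsOrbitIn v typeII2 y) (hv : 1 / 2 < v)
    (hs : ∀ t, y t ∈ separatrix v) (t : ℝ) : HasDerivAt (fun t => (y t).sigmaMinus)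
      ((radius v ^ 2 - (y t).sigmaMinus ^ 2) * (4 * v * (y t).sigmaMinus + 2 * √3)) t := by
  refine (hy.1 t).sigmaMinus.congr_deriv ?_
  have h := sq_eq_of_mem_separatrix hv (hy.2 t).1 (hs t)
  simp only [vectorField, one_sub_shearSq_of_mem_separatrix hv (hs t)]
  rw [(hy.2 t).2.2] at h ⊢
  rw [sub_zero] at h
  rw [h]
  ring

/-- In the plane, `Σ₋` obeys the autonomous equation `Σ₋' = (R² - Σ₋²)(4vΣ₋ + 2√3)` with positive
second factor, so it increases from `-R` to `R`. -/
theorem exists_typeII2_orbit (hv : 1 / 2 < v) (hv1 : v < 1) : ∃ y : ℝ → State,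
    IsOrbitIn v typeII2 y ∧ y 0 = midpointII2 v ∧
    Tendsto y atBot (𝓝 (kasnerPoint v (-radius v))) ∧
    Tendsto y atTop (𝓝 (kasnerPoint v (radius v))) ∧
    Set.range y = typeII2 ∩ separatrix v := by
  have hv0 : v ≠ 0 := by linarith
  have hm := midpointII2_mem hv
  obtain ⟨y, h0, hyc, hsgn⟩ := exists_orbit v (typeII2_subset hm)
  have hy : IsOrbitIn v typeII2 y := by
    refine ⟨hyc.1, fun t => ⟨(hyc.2 t).1, ?_, ?_⟩⟩
    · obtain ⟨c, hc, h⟩ := (hsgn t).1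
      rw [h]; exact mul_pos hm.2.1 hc
    · obtain ⟨c, hc, h⟩ := (hsgn t).2
      rw [h, hm.2.2, zero_mul]
  have hs := hy.mem_separatrix hv0 (by rw [h0]; rfl)
  have hY := hy.hasDerivAt_sigmaMinus_typeII2 hv hs
  have hb := fun t => abs_sigmaMinus_le hv (hy.2 t).1 (hs t)
  have hR := radius_pos hv
  have hRv := two_mul_radius_lt hv hv1
  have hfac : ∀ d, -radius v ≤ d → 0 < 4 * v * d + 2 * √3 := fun d hd => by nlinarith
  have hmono : Monotone fun t => (y t).sigmaMinus := by
    refine monotone_of_hasDerivAt_nonneg hY fun t => ?_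
    rw [Pi.zero_apply]
    exact mul_nonneg (by nlinarith [hb t]) (hfac _ (hb t).1).le
  have hY0 : (y 0).sigmaMinus = 0 := by rw [h0]; rfl
  have huc := hyc.uniformContinuous_comp (φ := fun p => (radius v ^ 2 - p.sigmaMinus ^ 2) *
    (4 * v * p.sigmaMinus + 2 * √3)) (by fun_prop)
  have hsq : ∀ {l : Filter ℝ} [l.NeBot] {d : ℝ}, Tendsto (fun t => (y t).sigmaMinus) l (𝓝 d) →
      Tendsto (fun t => (radius v ^ 2 - (y t).sigmaMinus ^ 2) *
        (4 * v * (y t).sigmaMinus + 2 * √3)) l (𝓝 0) → d ^ 2 = radius v ^ 2 := by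
    intro l _ d hd h'
    have h1 := tendsto_nhds_unique h' (((hd.pow 2).const_sub _).mul
      ((hd.const_mul (4 * v)).add_const (2 * √3)))
    have h2 := hfac d (ge_of_tendsto' hd fun t => (hb t).1)
    rcases mul_eq_zero.1 h1.symm with h | h <;> linarith
  have htop : Tendsto (fun t => (y t).sigmaMinus) atTop (𝓝 (radius v)) := by
    obtain ⟨d, hd, hle⟩ := hmono.exists_tendsto_atTop fun t => (hb t).2
    have := hsq hd (tendsto_deriv_zero_atTop hY huc hd)
    have h1 := hle 0
    rw [hY0] at h1
    rwa [(sq_eq_sq₀ h1 hR.le).1 this] at hd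
  have hbot : Tendsto (fun t => (y t).sigmaMinus) atBot (𝓝 (-radius v)) := by
    obtain ⟨d, hd, hle⟩ := hmono.exists_tendsto_atBot fun t => (hb t).1
    have := hsq hd (tendsto_deriv_zero_atBot hY huc hd)
    have h1 := hle 0
    rw [hY0] at h1
    rw [← neg_sq] at this
    rwa [← (sq_eq_sq₀ (by linarith) hR.le).1 this, neg_neg]
  refine ⟨y, hy, h0, tendsto_kasnerPoint hv hyc.2 hs (neg_sq _) hbot,
    tendsto_kasnerPoint hv hyc.2 hs rfl htop, ?_⟩
  refine Set.Subset.antisymm (by rintro _ ⟨t, rfl⟩; exact ⟨hy.2 t, hs t⟩) ?_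
  rintro q ⟨hq, hqs⟩
  have hqb := abs_sigmaMinus_lt hv hq.1 hqs (by rw [hq.2.2, sub_zero]; exact hq.2.1)
  have hcont : Continuous fun t => (y t).sigmaMinus := by
    have := hyc.continuous
    fun_prop
  -- `Σ₋` attains every value in `(-R, R)`, and in the plane it determines `N₂ > 0` through the
  -- constraint.
  obtain ⟨t, ht⟩ := mem_range_of_exists_le_of_exists_ge hcont
    ((hbot.eventually (gt_mem_nhds hqb.1)).exists.imp fun _ h => h.le)
    ((htop.eventually (lt_mem_nhds hqb.2)).exists.imp fun _ h => h.le)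
  refine ⟨t, ?_⟩
  have h1 := sq_eq_of_mem_separatrix hv (hy.2 t).1 (hs t)
  have h2 := sq_eq_of_mem_separatrix hv hq.1 hqs
  have ht' : (y t).sigmaMinus = q.sigmaMinus := ht
  rw [ht', ← h2, (hy.2 t).2.2, hq.2.2, sub_zero, sub_zero] at h1
  have h3 := (sq_eq_sq₀ (hy.2 t).2.1.le hq.2.1.le).1 h1
  ext
  exacts [(hs t).trans hqs.symm, ht', h3, (hy.2 t).2.2.trans hq.2.2.symm]

theorem reflect_kasnerPoint (d : ℝ) : reflect (kasnerPoint v d) = kasnerPoint v (-d) := by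
  simp [reflect, kasnerPoint, State.sigmaPlus, State.sigmaMinus, State.n2, State.n3]

theorem exists_typeII3_orbit (hv : 1 / 2 < v) (hv1 : v < 1) : ∃ z : ℝ → State,
    IsOrbitIn v typeII3 z ∧ z 0 = reflect (midpointII2 v) ∧
    Tendsto z atBot (𝓝 (kasnerPoint v (radius v))) ∧
    Tendsto z atTop (𝓝 (kasnerPoint v (-radius v))) ∧
    Set.range z = typeII3 ∩ separatrix v := by
  obtain ⟨y, hy, h0, hbot, htop, hran⟩ := exists_typeII2_orbit hv hv1
  refine ⟨fun t => reflect (y t), hy.reflect fun p => reflect_mem_typeII3, congrArg reflect h0,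
    ?_, ?_, ?_⟩
  · have := (continuous_reflect.tendsto _).comp hbot
    rwa [reflect_kasnerPoint, neg_neg] at this
  · have := (continuous_reflect.tendsto _).comp htop
    rwa [reflect_kasnerPoint] at this
  · ext q
    constructor
    · rintro ⟨t, rfl⟩
      obtain ⟨h1, h2⟩ := hran.subset ⟨t, rfl⟩
      exact ⟨reflect_mem_typeII3 h1, h2⟩
    · rintro ⟨h1, h2⟩
      obtain ⟨t, ht⟩ := hran.superset (show reflect q ∈ _ from ⟨reflect_mem_typeII2 h1, h2⟩)
      exact ⟨t, by simp only [ht, reflect_reflect]⟩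

theorem periodTwoCycle_eq (hv : 1 / 2 < v) : periodTwoCycle v =
    {kasnerPoint v (-radius v), kasnerPoint v (radius v)} ∪ (typeII2 ∩ separatrix v) ∪
      (typeII3 ∩ separatrix v) := by
  rw [periodTwoCycle, Set.union_inter_distrib_right, Set.union_inter_distrib_right,
    kasner_inter_separatrix hv, Set.union_comm, Set.union_assoc]

theorem isPeriodTwoHeteroclinicChain_periodTwoCycle (hv : 1 / 2 < v) (hv1 : v < 1) :
    IsPeriodTwoHeteroclinicChain v (periodTwoCycle v) := by
  obtain ⟨y, hy, -, hyb, hyt, hyr⟩ := exists_typeII2_orbit hv hv1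
  obtain ⟨z, hz, -, hzb, hzt, hzr⟩ := exists_typeII3_orbit hv hv1
  refine ⟨kasnerPoint v (-radius v), kasnerPoint v (radius v), y, z, kasnerPoint_mem hv (neg_sq _),
    kasnerPoint_mem hv rfl, fun h => ?_, hy, alphaLimitSet_eq_singleton hyb,
    omegaLimitSet_eq_singleton hyt, hz, alphaLimitSet_eq_singleton hzb,
    omegaLimitSet_eq_singleton hzt, ?_⟩
  · have := congrArg State.sigmaMinus h
    simp only [kasnerPoint, State.sigmaMinus] at this
    linarith [radius_pos hv]
  · rw [hyr, hzr, periodTwoCycle_eq hv]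

end Cycle

/-! ### The future of orbits in the invariant plane -/

theorem exists_zero_deriv_nonneg {f f' : ℝ → ℝ} (hf : ∀ t, HasDerivAt f (f' t) t) {s t : ℝ}
    (hst : s ≤ t) (hs : f s ≤ 0) (ht : 0 < f t) : ∃ r, s ≤ r ∧ f r = 0 ∧ 0 ≤ f' r := by
  by_contra! h
  have := image_le_of_deriv_right_lt_deriv_boundary (f := f) (f' := f') (a := s) (b := t)
    (B := fun _ => 0) (B' := fun _ => 0) (fun r _ => (hf r).continuousAt.continuousWithinAt)
    (fun r _ => (hf r).hasDerivWithinAt) hs (fun r => hasDerivAt_const r 0)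
    (fun r hr h0 => h r hr.1 h0) ⟨hst, le_rfl⟩
  linarith

section Omega

variable {v : ℝ} {x y : ℝ → State}

theorem four_mul_prod {p : State} (hv : 1 / 2 < v) (hC : p.Constraint) (hp : p ∈ separatrix v) :
    4 * -(p.n2 * p.n3) = radius v ^ 2 - p.sigmaMinus ^ 2 - (p.n2 + p.n3) ^ 2 := by
  rw [← sq_eq_of_mem_separatrix hv hC hp]
  ring

/-- A nonzero limit of the decreasing product forces `Σ₋ → 0`, hence convergence to the fixed point.
The limit is then `R²/4`, the maximum of the product in the plane, so the initial point already
attains it and is the fixed point. -/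
theorem IsOrbitIn.tendsto_prod_zero (hx : IsOrbitIn v typeVI0 x) (hv : 1 / 2 < v)
    (h0 : x 0 ∈ separatrix v) (hne : x 0 ≠ fixedPointVI0 v) :
    Tendsto (fun t => -((x t).n2 * (x t).n3)) atTop (𝓝 0) := by
  have hv0 : 0 < v := by linarith
  have hxc := hx.mono typeVI0_subset
  have hs := hx.mem_separatrix hv0.ne' h0
  have hw := fun t => mem_separatrix_iff.1 (hs t)
  have hP' : ∀ t, HasDerivAt (fun t => -((x t).n2 * (x t).n3))
      (-8 * v * (x t).sigmaMinus ^ 2 * -((x t).n2 * (x t).n3)) t := fun t =>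
    (hx.hasDerivAt_prod hv0.ne' t).congr_deriv (by rw [hw t, mul_zero, sub_zero])
  have hanti : Antitone fun t => -((x t).n2 * (x t).n3) :=
    antitone_of_hasDerivAt_nonpos hP' fun t =>
      mul_nonpos_of_nonpos_of_nonneg (by nlinarith [sq_nonneg (x t).sigmaMinus])
        (prod_pos (hx.2 t)).le
  obtain ⟨l, hl, hle⟩ := hanti.exists_tendsto_atTop fun t => (prod_pos (hx.2 t)).le
  by_cases hl0 : l = 0
  · rwa [hl0] at hl
  exfalso
  have hd := tendsto_deriv_zero_atTop hP' (hxc.uniformContinuous_comp (φ := fun p =>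
    -8 * v * p.sigmaMinus ^ 2 * -(p.n2 * p.n3)) (by fun_prop)) hl
  have hYsq : Tendsto (fun t => (x t).sigmaMinus ^ 2) atTop (𝓝 (0 ^ 2)) := by
    have := (hd.div hl hl0).div_const (-8 * v)
    rw [zero_div, zero_div] at this
    rw [zero_pow two_ne_zero]
    refine this.congr fun t => ?_
    rw [Pi.div_apply, mul_div_cancel_right₀ _ (prod_pos (hx.2 t)).ne',
      mul_div_cancel_left₀ _ (by linarith)]
  obtain ⟨d, hd, hY⟩ := Continuous.exists_tendsto_of_sq_atTop
    (by have := hx.continuous; fun_prop) hYsq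
  have hd0 : d = 0 := by simpa using hd
  rw [hd0] at hY
  have hlim := tendsto_fixedPointVI0 hv hxc.2 (tendsto_const_nhds.congr fun t => (hw t).symm) hY
    (tendsto_deriv_zero_atTop (fun t => (hx.1 t).sigmaMinus) (hxc.uniformContinuous_comp
      (φ := fun p => (vectorField v p).sigmaMinus) (by unfold vectorField; fun_prop)) hY)
  have hcont : Continuous fun p : State => -(p.n2 * p.n3) := by fun_prop
  have h1 := hle 0
  rw [tendsto_nhds_unique hl ((hcont.tendsto _).comp hlim)] at h1
  have h2 : -((fixedPointVI0 v).n2 * (fixedPointVI0 v).n3) = radius v ^ 2 / 4 := by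
    simp only [fixedPointVI0, radius, State.n2, State.n3]
    ring
  rw [h2] at h1
  have h3 := four_mul_prod hv (hx.2 0).1 h0
  have hY0 : (x 0).sigmaMinus = 0 := by
    apply pow_eq_zero_iff two_ne_zero |>.1
    nlinarith [sq_nonneg (x 0).sigmaMinus, sq_nonneg ((x 0).n2 + (x 0).n3)]
  have hsum : (x 0).n2 + (x 0).n3 = 0 := by
    apply pow_eq_zero_iff two_ne_zero |>.1
    nlinarith [sq_nonneg (x 0).sigmaMinus, sq_nonneg ((x 0).n2 + (x 0).n3)]
  have h4 := sq_eq_of_mem_separatrix hv (hx.2 0).1 h0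
  rw [hY0, zero_pow two_ne_zero, sub_zero] at h4
  have h5 := (sq_eq_sq₀ (by linarith [(hx.2 0).2.1, (hx.2 0).2.2]) (radius_pos hv).le).1 h4
  apply hne
  ext
  · exact h0
  · exact hY0
  · change (x 0).n2 = radius v / 2
    linarith
  · change (x 0).n3 = -(radius v / 2)
    linarith

theorem IsOrbitIn.hasDerivAt_ratio (hx : IsOrbitIn v typeVI0 x) (t : ℝ) :
    HasDerivAt (fun t => (x t).n2 / -(x t).n3)
      (-4 * √3 * (x t).sigmaMinus * ((x t).n2 / -(x t).n3)) t := by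
  have h3 := (hx.2 t).2.2.ne
  refine ((hx.hasDerivAt_n2 t).div (hx.hasDerivAt_neg_n3 t) (neg_ne_zero.2 h3)).congr_deriv ?_
  simp only [rate2, rate3, State.sigma2, State.sigma3]
  field_simp
  ring

/-- The orbits on the separatrix do not stay in the half space `Σ₋ ≥ 0`. -/
theorem IsOrbitIn.exists_sigmaMinus_neg (hx : IsOrbitIn v typeVI0 x) (hv : 1 / 2 < v) (hv1 : v < 1)
    (h0 : x 0 ∈ separatrix v) (hne : x 0 ≠ fixedPointVI0 v) (T : ℝ) :
    ∃ t, T ≤ t ∧ (x t).sigmaMinus < 0 := by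
  by_contra! hY0
  have hv0 : 0 < v := by linarith
  have hxc := hx.mono typeVI0_subset
  have hs := hx.mem_separatrix hv0.ne' h0
  have hR := radius_pos hv
  have hRv := two_mul_radius_lt hv hv1
  have hu := fun t => sq_eq_of_mem_separatrix hv (hx.2 t).1 (hs t)
  have hYR : ∀ t, -radius v < (x t).sigmaMinus ∧ (x t).sigmaMinus < radius v := fun t =>
    abs_sigmaMinus_lt hv (hx.2 t).1 (hs t) (by linarith [(hx.2 t).2.1, (hx.2 t).2.2])
  set ρ : ℝ → ℝ := fun t => (x t).n2 / -(x t).n3 with hρ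
  have hρ0 : ∀ t, 0 < ρ t := fun t => div_pos (hx.2 t).2.1 (neg_pos.2 (hx.2 t).2.2)
  have hn2 : ∀ t, (x t).n2 = -(ρ t * (x t).n3) := fun t => by
    have := (hx.2 t).2.2.ne
    simp only [hρ]
    field_simp
  have hanti : AntitoneOn ρ (Set.Ici T) := by
    -- While `Σ₋ ≥ 0`, the ratio `N₂ / -N₃` cannot increase. Its limit is either positive, which
    -- drives the orbit to a Kasner point, or zero, which makes the dynamics asymptotically type
    -- II₃.
    refine antitoneOn_Ici_of_hasDerivAt_nonpos hx.hasDerivAt_ratio fun t ht => ?_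
    have := mul_nonneg (mul_nonneg (Real.sqrt_nonneg 3) (hY0 t ht)) (hρ0 t).le
    simp only [hρ] at this
    linarith
  obtain ⟨r, hr, -⟩ := hanti.exists_tendsto_atTop (C := 0) fun t _ => (hρ0 t).le
  have hr0 : 0 ≤ r := ge_of_tendsto' hr fun t => (hρ0 t).le
  rcases hr0.lt_or_eq with hr0 | hr0
  · have hn3 : Tendsto (fun t => (x t).n3 ^ 2) atTop (𝓝 0) := by
      have := (hx.tendsto_prod_zero hv h0 hne).div hr hr0.ne'
      rw [zero_div] at this
      refine this.congr fun t => ?_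
      rw [Pi.div_apply, div_eq_iff (hρ0 t).ne', hn2 t]
      ring
    have hYsq : Tendsto (fun t => (x t).sigmaMinus ^ 2) atTop (𝓝 (radius v ^ 2)) := by
      have := (hn3.mul ((hr.add_const 1).pow 2)).const_sub (radius v ^ 2)
      rw [zero_mul, sub_zero] at this
      refine this.congr fun t => ?_
      have h := hu t
      rw [hn2 t] at h
      linear_combination -h
    obtain ⟨d, hd, hYd⟩ := Continuous.exists_tendsto_of_sq_atTop
      (by have := hx.continuous; fun_prop) hYsq
    have hd0 : 0 ≤ d := ge_of_tendsto hYd (by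
      filter_upwards [eventually_ge_atTop T] with t ht using hY0 t ht)
    rw [(sq_eq_sq₀ hd0 hR.le).1 hd] at hYd
    -- At the Kasner point with `Σ₋ = R`, non-growth of `-N₃` would require `√3 ≤ 2vR`.
    have := (hx.sigma_ge_of_tendsto_atTop (kasnerPoint_mem hv rfl)
      (tendsto_kasnerPoint hv hxc.2 hs rfl hYd)).2
    simp only [State.sigma3, kasnerPoint, State.sigmaPlus, State.sigmaMinus] at this
    have h1 : 2 * v * radius v ^ 2 = 2 * v - 1 / (2 * v) := by
      rw [radius_sq hv]
      field_simp
      ring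
    have h2 : -1 / (2 * v) = -(1 / (2 * v)) := by ring
    nlinarith
  · have hr' : Tendsto ρ atTop (𝓝 0) := by rwa [hr0]
    have hY' : ∀ t, HasDerivAt (fun t => (x t).sigmaMinus) ((x t).n3 ^ 2 *
        (4 * v * (1 + ρ t) ^ 2 * (x t).sigmaMinus + 2 * √3 * (ρ t ^ 2 - 1))) t := fun t => by
      refine (hx.1 t).sigmaMinus.congr_deriv ?_
      simp only [vectorField]
      rw [(hx.2 t).1.one_sub_shearSq, hn2 t]
      ring
    -- The bracket in `Σ₋'` is bounded above by its value at `Σ₋ = R`, which tends to `4vR - 2√3 <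
    -- 0`; so `Σ₋` eventually decreases.
    have hbr : ∀ᶠ t in atTop, 4 * v * (1 + ρ t) ^ 2 * radius v + 2 * √3 * (ρ t ^ 2 - 1) < 0 := by
      have : Tendsto (fun t => 4 * v * (1 + ρ t) ^ 2 * radius v + 2 * √3 * (ρ t ^ 2 - 1)) atTop
          (𝓝 (4 * v * (1 + 0) ^ 2 * radius v + 2 * √3 * (0 ^ 2 - 1))) :=
        ((((hr'.const_add 1).pow 2).const_mul (4 * v)).mul_const _).add
          (((hr'.pow 2).sub_const 1).const_mul _)
      exact this.eventually (gt_mem_nhds (by nlinarith))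
    obtain ⟨S, hS⟩ := eventually_atTop.1 hbr
    have hYanti : AntitoneOn (fun t => (x t).sigmaMinus) (Set.Ici S) := by
      refine antitoneOn_Ici_of_hasDerivAt_nonpos hY' fun t ht => ?_
      refine mul_nonpos_of_nonneg_of_nonpos (sq_nonneg _) ((hS t ht).le.trans' ?_)
      have := mul_le_mul_of_nonneg_left (hYR t).2.le
        (show 0 ≤ 4 * v * (1 + ρ t) ^ 2 by positivity)
      linarith
    obtain ⟨d, hd, hle⟩ := hYanti.exists_tendsto_atTop fun t _ => (hYR t).1.le
    have hd0 : 0 ≤ d := ge_of_tendsto hd (by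
      filter_upwards [eventually_ge_atTop T] with t ht using hY0 t ht)
    have hdR : d < radius v := (hle S le_rfl).trans_lt (hYR S).2
    have hlim := tendsto_deriv_zero_atTop (fun t => (hx.1 t).sigmaMinus)
      (hxc.uniformContinuous_comp (φ := fun p => (vectorField v p).sigmaMinus)
        (by unfold vectorField; fun_prop)) hd
    -- Writing `N₃² = (R² - Σ₋²) / (1 + ρ)²` gives the limit `(R² - d²)(4vd - 2√3)` of `Σ₋'`. It is
    -- negative for `0 ≤ d < R`, whereas Barbalat's lemma gives zero.
    have hlim' : Tendsto (fun t => (vectorField v (x t)).sigmaMinus) atTop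
        (𝓝 ((radius v ^ 2 - d ^ 2) / (1 + 0) ^ 2 *
          (4 * v * (1 + 0) ^ 2 * d + 2 * √3 * (0 ^ 2 - 1)))) := by
      have h1 := ((hd.pow 2).const_sub (radius v ^ 2)).div ((hr'.const_add 1).pow 2)
        (by norm_num)
      have h2 := ((((hr'.const_add 1).pow 2).const_mul (4 * v)).mul hd).add
          (((hr'.pow 2).sub_const 1).const_mul (2 * √3))
      refine (h1.mul h2).congr fun t => ?_
      rw [(hx.1 t).sigmaMinus.unique (hY' t)]
      have h3 := hu t
      have h4 : 1 + ρ t ≠ 0 := by linarith [hρ0 t]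
      rw [Pi.div_apply]
      congr 1
      rw [← h3, hn2 t, div_eq_iff (pow_ne_zero 2 h4)]
      ring
    have := tendsto_nhds_unique hlim hlim'
    have h1 : 0 < radius v ^ 2 - d ^ 2 := by nlinarith
    have h2 : 4 * v * d < 2 * √3 := by nlinarith
    nlinarith

theorem reflect_fixedPointVI0 : reflect (fixedPointVI0 v) = fixedPointVI0 v := by
  simp [reflect, fixedPointVI0, State.sigmaPlus, State.sigmaMinus, State.n2, State.n3]

theorem IsOrbitIn.exists_sigmaMinus_pos (hx : IsOrbitIn v typeVI0 x) (hv : 1 / 2 < v) (hv1 : v < 1)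
    (h0 : x 0 ∈ separatrix v) (hne : x 0 ≠ fixedPointVI0 v) (T : ℝ) :
    ∃ t, T ≤ t ∧ 0 < (x t).sigmaMinus := by
  obtain ⟨t, ht, h⟩ := (hx.reflect fun p => reflect_mem_typeVI0).exists_sigmaMinus_neg hv hv1 h0
    (fun h => hne (by rw [← reflect_reflect (x 0), h, reflect_fixedPointVI0])) T
  exact ⟨t, ht, neg_lt_zero.1 h⟩

theorem IsOrbitIn.mapClusterPt_midpointII2 (hx : IsOrbitIn v typeVI0 x) (hv : 1 / 2 < v)
    (hv1 : v < 1) (h0 : x 0 ∈ separatrix v) (hne : x 0 ≠ fixedPointVI0 v) :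
    MapClusterPt (midpointII2 v) atTop x := by
  have hs := hx.mem_separatrix (by linarith) h0
  have hu := fun t => sq_eq_of_mem_separatrix hv (hx.2 t).1 (hs t)
  -- These times include zeros of `Σ₋` with `Σ₋' ≥ 0`, since there `Σ₋' = 2√3 (N₂² - N₃²)`. Along
  -- `D`, `N₃² ≤ -N₂N₃ → 0`, and the constraint gives `N₂ → R`.
  set D : Set ℝ := {t | (x t).sigmaMinus = 0 ∧ -(x t).n3 ≤ (x t).n2} with hD
  have hfreq : ∃ᶠ t in atTop, t ∈ D := by
    rw [frequently_atTop]
    intro T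
    obtain ⟨t₁, ht₁, h₁⟩ := hx.exists_sigmaMinus_neg hv hv1 h0 hne T
    obtain ⟨t₂, ht₂, h₂⟩ := hx.exists_sigmaMinus_pos hv hv1 h0 hne t₁
    obtain ⟨t, ht, hY, hY'⟩ :=
      exists_zero_deriv_nonneg (fun t => (hx.1 t).sigmaMinus) ht₂ h₁.le h₂
    refine ⟨t, ht₁.trans ht, hY, ?_⟩
    simp only [vectorField] at hY'
    rw [hY, mul_zero, zero_add] at hY'
    have hsq := nonneg_of_mul_nonneg_right hY' (by positivity)
    nlinarith [(hx.2 t).2.1, (hx.2 t).2.2]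
  have : (atTop ⊓ 𝓟 D).NeBot := frequently_mem_iff_neBot.1 hfreq
  have hmem : ∀ᶠ t in atTop ⊓ 𝓟 D, t ∈ D :=
    eventually_inf_principal.2 (Eventually.of_forall fun _ h => h)
  have hn3 : Tendsto (fun t => -(x t).n3) (atTop ⊓ 𝓟 D) (𝓝 0) := by
    have h := ((hx.tendsto_prod_zero hv h0 hne).mono_left (inf_le_left (b := 𝓟 D))).sqrt
    rw [Real.sqrt_zero] at h
    refine squeeze_zero' (Eventually.of_forall fun t => (neg_pos.2 (hx.2 t).2.2).le) ?_ h
    filter_upwards [hmem] with t ht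
    apply Real.le_sqrt_of_sq_le
    nlinarith [ht.2, (hx.2 t).2.2]
  refine MapClusterPt.mono (Tendsto.mapClusterPt (F := atTop ⊓ 𝓟 D) ?_) inf_le_left
  refine State.tendsto_of_components (tendsto_const_nhds.congr fun t => (hs t).symm)
    (tendsto_const_nhds.congr' ?_) ?_
    (by simpa [midpointII2, State.n3] using hn3.neg)
  · filter_upwards [hmem] with t ht using ht.1.symm
  · have := hn3.const_sub (radius v)
    rw [sub_zero] at this
    refine this.congr' ?_
    filter_upwards [hmem] with t ht
    have h := hu t
    rw [ht.1, zero_pow two_ne_zero, sub_zero] at h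
    linarith [(sq_eq_sq₀ (by linarith [(hx.2 t).2.1, (hx.2 t).2.2]) (radius_pos hv).le).1 h]

/-- The limit points of an orbit form an invariant set. -/
theorem IsOrbitIn.mapClusterPt_of_zero (hx : IsOrbitIn v closedVI0 x)
    (hy : IsOrbitIn v closedVI0 y) (h : MapClusterPt (y 0) atTop x) (t : ℝ) :
    MapClusterPt (y t) atTop x := by
  obtain ⟨K, hK⟩ := hx.exists_dist_le hy
  rw [Metric.nhds_basis_ball.mapClusterPt_iff_frequently] at h ⊢
  intro ε hε
  -- The shrunken radius offsets the growth factor `exp (K |t|)` in the continuous dependence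
  -- estimate.
  have h1 := h (ε * Real.exp (-(K * |t|))) (by positivity)
  rw [frequently_atTop] at h1 ⊢
  intro T
  obtain ⟨s, hs, hd⟩ := h1 (T - t)
  refine ⟨s + t, by linarith, ?_⟩
  rw [Metric.mem_ball] at hd ⊢
  calc dist (x (s + t)) (y t) ≤ dist (x s) (y 0) * Real.exp (K * |t|) := hK s t
    _ < ε * Real.exp (-(K * |t|)) * Real.exp (K * |t|) := by gcongr
    _ = ε := by rw [mul_assoc, ← Real.exp_add, neg_add_cancel, Real.exp_zero, mul_one]

theorem IsOrbitIn.range_subset_omegaLimitSet (hx : IsOrbitIn v closedVI0 x)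
    (hy : IsOrbitIn v closedVI0 y) (h : MapClusterPt (y 0) atTop x) :
    Set.range y ⊆ omegaLimitSet x := by
  rintro _ ⟨t, rfl⟩
  exact mem_omegaLimitSet.2 (hx.mapClusterPt_of_zero hy h t)

theorem isClosed_closedVI0 : IsClosed closedVI0 := by
  have h1 : IsClosed {p : State | p.Constraint} := by
    unfold State.Constraint
    exact isClosed_eq (by fun_prop) continuous_const
  have h2 : Continuous fun p : State => p.n2 := by fun_prop
  have h3 : Continuous fun p : State => p.n3 := by fun_prop
  exact h1.inter ((isClosed_le continuous_const h2).inter (isClosed_le h3 continuous_const))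

theorem isClosed_separatrix : IsClosed (separatrix v) :=
  isClosed_eq (by fun_prop) continuous_const

theorem IsOrbitIn.omegaLimitSet_eq_periodTwoCycle (hx : IsOrbitIn v typeVI0 x) (hv : 1 / 2 < v)
    (hv1 : v < 1) (h0 : x 0 ∈ separatrix v) (hne : x 0 ≠ fixedPointVI0 v) :
    omegaLimitSet x = periodTwoCycle v := by
  have hxc := hx.mono typeVI0_subset
  have hs := hx.mem_separatrix (by linarith) h0
  apply Set.Subset.antisymm
  · intro q hq
    rw [mem_omegaLimitSet] at hq
    obtain ⟨hC, h2, h3⟩ := isClosed_closedVI0.mem_of_mapClusterPt hq (.of_forall hxc.2)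
    refine ⟨?_, isClosed_separatrix.mem_of_mapClusterPt hq (.of_forall hs)⟩
    have hcont : Continuous fun p : State => -(p.n2 * p.n3) := by fun_prop
    have hq0 := (hq.continuousAt_comp hcont.continuousAt).eq_of_tendsto
      (hx.tendsto_prod_zero hv h0 hne)
    rcases h2.lt_or_eq with h2 | h2
    · have : q.n3 = 0 := by
        rcases mul_eq_zero.1 (neg_eq_zero.1 hq0) with h | h
        · exact absurd h h2.ne'
        · exact h
      exact Or.inl (Or.inl ⟨hC, h2, this⟩)
    · rcases h3.lt_or_eq with h3 | h3
      · exact Or.inl (Or.inr ⟨hC, h2.symm, h3⟩)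
      · exact Or.inr ⟨hC, h2.symm, h3⟩
  · obtain ⟨y, hy, hy0, hyb, hyt, hyr⟩ := exists_typeII2_orbit hv hv1
    obtain ⟨z, hz, hz0, -, -, hzr⟩ := exists_typeII3_orbit hv hv1
    have h2 := hxc.range_subset_omegaLimitSet (hy.mono typeII2_subset)
      (hy0 ▸ hx.mapClusterPt_midpointII2 hv hv1 h0 hne)
    -- The reflected orbit accumulates at the type II₂ midpoint, so the orbit itself accumulates at
    -- its mirror image on the type II₃ orbit.
    have hm := (hx.reflect fun p => reflect_mem_typeVI0).mapClusterPt_midpointII2 hv hv1 h0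
      (fun h => hne (by rw [← reflect_reflect (x 0), h, reflect_fixedPointVI0]))
    have h3 := hxc.range_subset_omegaLimitSet (hz.mono typeII3_subset) (by
      have := hm.continuousAt_comp continuous_reflect.continuousAt
      rw [hz0]
      simpa only [Function.comp_def, reflect_reflect] using this)
    have hcl : IsClosed (omegaLimitSet x) := isClosed_omegaLimit _ _ _
    rw [periodTwoCycle_eq hv, ← hyr, ← hzr]
    refine Set.union_subset (Set.union_subset ?_ h2) h3
    rintro q (rfl | rfl)
    · exact hcl.mem_of_tendsto hyb (Eventually.of_forall fun t => h2 ⟨t, rfl⟩)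
    · exact hcl.mem_of_tendsto hyt (Eventually.of_forall fun t => h2 ⟨t, rfl⟩)

end Omega

/-! ### Assembly of the cases -/

theorem mainTheorem7 (v : ℝ) (hv0 : 0 < v) (hv1 : v < 1) :
    -- every point of the state space lies on exactly one orbit, defined for all times
    (∀ s ∈ typeVI0, ∃! x : ℝ → State, IsOrbitIn v typeVI0 x ∧ x 0 = s) ∧
    -- subcritical and critical case
    (v ≤ 1 / 2 → ∀ x : ℝ → State, IsOrbitIn v typeVI0 x →
      ((alphaLimitSet x).Nonempty ∧ alphaLimitSet x ⊆ arcA2 v ∩ arcA3 v) ∧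
      ((omegaLimitSet x).Nonempty ∧ omegaLimitSet x ⊆ stableSet v)) ∧
    (v = 1 / 2 → arcA2 v ∩ arcA3 v = {taubT1} ∧
      ∀ x : ℝ → State, IsOrbitIn v typeVI0 x → alphaLimitSet x = {taubT1}) ∧
    -- supercritical case
    (1 / 2 < v →
      IsOrbitIn v typeVI0 (fun _ => fixedPointVI0 v) ∧
      (∀ x : ℝ → State, IsOrbitIn v typeVI0 x → alphaLimitSet x = {fixedPointVI0 v}) ∧
      IsPeriodTwoHeteroclinicChain v (periodTwoCycle v) ∧
      (∀ x : ℝ → State, IsOrbitIn v typeVI0 x → x 0 ∈ separatrix v →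
        (∀ t, x t ∈ separatrix v) ∧
        (x 0 ≠ fixedPointVI0 v → omegaLimitSet x = periodTwoCycle v)) ∧
      (∀ x : ℝ → State, IsOrbitIn v typeVI0 x → x 0 ∉ separatrix v →
        (omegaLimitSet x).Nonempty ∧ omegaLimitSet x ⊆ stableSet v)) := by
  have homega : ∀ x : ℝ → State, IsOrbitIn v typeVI0 x → x 0 ∉ separatrix v →
      (omegaLimitSet x).Nonempty ∧ omegaLimitSet x ⊆ stableSet v := fun x hx h => by
    obtain ⟨p, hp, hlim⟩ := hx.exists_tendsto_stable hv0 hv1 (fun h' => h (mem_separatrix_iff.2 h'))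
    rw [omegaLimitSet_eq_singleton hlim]
    exact ⟨Set.singleton_nonempty p, Set.singleton_subset_iff.2 hp⟩
  refine ⟨fun s hs => existsUnique_orbit_typeVI0 v hs, fun hv x hx => ⟨?_, homega x hx ?_⟩,
    ?_, fun hv => ⟨isOrbitIn_fixedPointVI0 hv, fun x hx =>
      alphaLimitSet_eq_singleton (hx.tendsto_fixedPointVI0_atBot hv),
      isPeriodTwoHeteroclinicChain_periodTwoCycle hv hv1, fun x hx h0 =>
      ⟨hx.mem_separatrix hv0.ne' h0, hx.omegaLimitSet_eq_periodTwoCycle hv hv1 h0⟩, homega⟩⟩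
  · obtain ⟨p, hp, hlim⟩ := hx.exists_tendsto_arcs hv0 hv
    rw [alphaLimitSet_eq_singleton hlim]
    exact ⟨Set.singleton_nonempty p, Set.singleton_subset_iff.2 hp⟩
  -- For `v ≤ 1/2` the plane has `Σ₊ ≤ -1`, so `Σ² ≥ 1`, which contradicts `1 - Σ² = (N₂ - N₃)² >
  -- 0`; hence no type VI₀ orbit starts there.
  · intro h
    have h1 : 1 ≤ 1 / (2 * v) := by rw [le_div_iff₀ (by positivity)]; linarith
    have h2 := (hx.2 0).1.one_sub_shearSq
    have h3 := mem_separatrix_iff.1 h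
    have h4 : 0 < (x 0).n2 - (x 0).n3 := by linarith [(hx.2 0).2.1, (hx.2 0).2.2]
    simp only [State.shearSq] at h2
    nlinarith [sq_nonneg (x 0).sigmaMinus]
  · rintro rfl
    refine ⟨arcA2_inter_arcA3_half, fun x hx => ?_⟩
    obtain ⟨p, hp, hlim⟩ := hx.exists_tendsto_arcs hv0 le_rfl
    rw [arcA2_inter_arcA3_half] at hp
    rw [alphaLimitSet_eq_singleton hlim, Set.mem_singleton_iff.1 hp]
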